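/- Let $d\ge 3$, $m\ge 2$, let $\Omega\subset\mathbb R^d$ be a bounded open set (for example a bounded Lipschitz domain), and let $\theta\in(0,1]$, $M\ge 0$. Write $D=-i\nabla$, $\hat u(\xi)=\int e^{-ix\cdot\xi}u(x)\,dx$, and $\|g\|_{C^\theta}=\sup_x|g(x)|+\sup_{x\ne y}|g(x)-g(y)|/|x-y|^\theta$. Let $\mathcal V$ be the set of $\zeta=\mu_1+i\mu_2\in\mathbb C^d$ with $\mu_1,\mu_2\in\mathbb R^d$ orthonormal. For $\zeta\in\mathcal V$ and $h>0$ put $P_\zeta(\xi)=|\xi|^2-2i\,\zeta\cdot\xi$, so that $P_\zeta(hD)=e^{-x\cdot\zeta/h}(-h^2\Delta)e^{x\cdot\zeta/h}$, and for $\lambda\in\mathbb R$ let $X^\lambda=X^\lambda_{h\zeta}$ be the space of all $u\in\mathcal S'(\mathbb R^d)$ such that $\hat u$ is a function and $$\|u\|_{X^\lambda}^2=\int_{\mathbb R^d}|\hat u(\xi)|^2\,(h+|P_\zeta(h\xi)|)^{2\lambda}\,d\xi<\infty .$$ Then there are $h_0\in(0,1)$ and $C<\infty$, depending only on $d,m,\Omega,\theta,M$,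 with the following property. Suppose that $$Q_j=\sum_{|\beta|\le m-1}D^\beta Q_{j\beta}\quad(1\le j\le d),\qquad q=\sum_{|\beta|\le m}D^\beta q_\beta ,$$ where the functions $Q_{j\beta},q_\beta:\mathbb R^d\to\mathbb C$ are supported in $\bar\Omega$ and have $C^\theta(\mathbb R^d)$-norm at most $M$. Let $\zeta\in\mathcal V$, $0<h\le h_0$ and $$L_\zeta=P_\zeta(hD)^m+h^{2m}\,Q\cdot\Big(\frac{\zeta}{ih}+D\Big)+h^{2m}q .$$ Then for every $f\in X^{-m/2}$ there is $\psi\in X^{m/2}\cap W^{m,2}(\mathbb R^d)$ that solves $L_\zeta\psi=f$ in the sense of distributions in $\Omega$ and satisfies $$\|\psi\|_{X^{m/2}}\le C\,\|f\|_{X^{-m/2}} .$$ Here the products of $Q_j$ with $\frac{\zeta_j}{ih}\psi+D_j\psi\in W^{m-1,2}(\mathbb R^d)$ and of $q$ with $\psi\in W^{m,2}(\mathbb R^d)$ are the extensions by continuity, in the $W^{m-1,2}$ and $W^{m,2}$ norm respectively, of the products with Schwartz functions. -/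

import Mathlib

open MeasureTheory Filter Topology FourierTransform SchwartzMap LineDeriv Laplacian
open scoped NNReal ENNReal

namespace Polyharmonic

/-- The Euclidean space `ℝ^d`. -/
abbrev Eu (d : ℕ) := EuclideanSpace ℝ (Fin d)

/-- Complex-valued tempered distributions on `ℝ^d`. -/
abbrev TD (d : ℕ) := TemperedDistribution (Eu d) ℂ

/-- The set of vectors `ζ = μ₁ + i μ₂` with `μ₁, μ₂ ∈ ℝ^d` orthonormal. -/
def zetaSet (d : ℕ) : Set (Fin d → ℂ) :=
  {ζ | ∃ μ₁ μ₂ : Eu d, ‖μ₁‖ = 1 ∧ ‖μ₂‖ = 1 ∧ inner ℝ μ₁ μ₂ = 0 ∧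
    ∀ j, ζ j = (μ₁ j : ℂ) + Complex.I * (μ₂ j : ℂ)}

/-- The symbol `P_ζ(ξ) = |ξ|² - 2 i ζ · ξ`. -/
noncomputable def symbolP {d : ℕ} (ζ : Fin d → ℂ) (ξ : Eu d) : ℂ :=
  ((‖ξ‖ ^ 2 : ℝ) : ℂ) - 2 * Complex.I * ∑ j, ζ j * (ξ j : ℂ)

/-- `D_j = -i ∂_j` on tempered distributions. -/
noncomputable def D {d : ℕ} (j : Fin d) (u : TD d) : TD d :=
  (-Complex.I) • ∂_{(EuclideanSpace.single j (1 : ℝ) : Eu d)} u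

/-- `D^β = D_1^{β_1} ⋯ D_d^{β_d}` for a multi-index `β`. -/
noncomputable def Dpow {d : ℕ} (β : Fin d → ℕ) (u : TD d) : TD d :=
  (List.finRange d).foldr (fun j w => (D j)^[β j] w) u

/-- The multi-indices `β` with `|β| ≤ k`. -/
def multiIndices (d k : ℕ) : Finset (Fin d → ℕ) :=
  (Fintype.piFinset fun _ => Finset.range (k + 1)).filter fun β => ∑ j, β j ≤ k

theorem mem_multiIndices {d k : ℕ} (β : Fin d → ℕ) : β ∈ multiIndices d k ↔ ∑ j, β j ≤ k := by
  simp only [multiIndices, Finset.mem_filter, Fintype.mem_piFinset, Finset.mem_range,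
    and_iff_right_iff_imp]
  intro hβ j
  have := Finset.single_le_sum (f := β) (fun i _ => Nat.zero_le _) (Finset.mem_univ j)
  omega

/-- `P_ζ(hD) = e^{-x·ζ/h} (-h²Δ) e^{x·ζ/h}`, the constant coefficient operator with symbol
`P_ζ(hξ)`, that is, `P_ζ(hD) u = -h²Δu - 2 i h ∑_j ζ_j D_j u`. -/
noncomputable def opP {d : ℕ} (ζ : Fin d → ℂ) (h : ℝ) (u : TD d) : TD d :=
  ((h : ℂ) ^ 2) • (-(Δ u)) - (2 * Complex.I * (h : ℂ)) • ∑ j, ζ j • D j u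

/-- The tempered distribution `T` is (given by integration against) the locally integrable
function `g`. -/
def IsFunction {d : ℕ} (T : TD d) (g : Eu d → ℂ) : Prop :=
  LocallyIntegrable g ∧ ∀ v : 𝓢(Eu d, ℂ), HasCompactSupport v → T v = ∫ x, v x * g x

/-- The norm of `u` in `X^μ_{hζ}`,
`(∫ |û(ξ)|² (h + |P_ζ(hξ)|)^{2μ} dξ)^{1/2}` where `û(ξ) = ∫ e^{-i x·ξ} u(x) dx`;
it is `∞` if `û` is not a function.
The Fourier transform `𝓕` of Mathlib is normalized so that `û(ξ) = (𝓕 u)(ξ / 2π)`. -/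
noncomputable def xNorm {d : ℕ} (ζ : Fin d → ℂ) (h μ : ℝ) (u : TD d) : ℝ≥0∞ :=
  ⨅ (g : Eu d → ℂ) (_ : IsFunction (𝓕 u) g),
    (∫⁻ ξ : Eu d, ‖g ((2 * Real.pi)⁻¹ • ξ)‖ₑ ^ 2 *
      ENNReal.ofReal ((h + ‖symbolP ζ (h • ξ)‖) ^ (2 * μ))) ^ (1 / 2 : ℝ)

/-- `u ∈ X^μ_{hζ}`. -/
def MemX {d : ℕ} (ζ : Fin d → ℂ) (h μ : ℝ) (u : TD d) : Prop := xNorm ζ h μ u < ∞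

/-- The norm in `C^θ(ℝ^d)`: the supremum norm plus the Hölder seminorm. -/
noncomputable def holderENorm {d : ℕ} (θ : ℝ≥0) (g : Eu d → ℂ) : ℝ≥0∞ :=
  (⨆ x, ‖g x‖ₑ) + eHolderNorm θ g

open Classical in
/-- A bounded measurable function as a tempered distribution (`0` for other functions). -/
noncomputable def ofBounded {d : ℕ} (g : Eu d → ℂ) : TD d :=
  if hg : MemLp g ∞ volume then Lp.toTemperedDistribution (hg.toLp g) else 0

theorem memLp_top_of_holderENorm {d : ℕ} {θ : ℝ≥0} (hθ : 0 < θ) {g : Eu d → ℂ}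
    (hg : holderENorm θ g < ∞) : MemLp g ∞ volume := by
  obtain ⟨h1, h2⟩ := ENNReal.add_lt_top.1 hg
  obtain ⟨K, hK⟩ := eHolderNorm_lt_top.1 h2
  refine ⟨(hK.continuous hθ).aestronglyMeasurable, ?_⟩
  rw [eLpNorm_exponent_top]
  exact lt_of_le_of_lt (eLpNormEssSup_le_of_ae_enorm_bound
    (Eventually.of_forall fun x => le_iSup (fun x => ‖g x‖ₑ) x)) h1

theorem ofBounded_apply {d : ℕ} {g : Eu d → ℂ} (hg : MemLp g ∞ volume) (v : 𝓢(Eu d, ℂ)) :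
    ofBounded g v = ∫ x, v x * g x := by
  rw [ofBounded, dif_pos hg, Lp.toTemperedDistribution_apply]
  refine integral_congr_ae ?_
  filter_upwards [hg.coeFn_toLp] with x hx
  simp [hx]

/-- The norm of the `L²`-Sobolev space `W^{k,2}(ℝ^d)` in its Bessel potential form
(`∞` outside of this space). -/
noncomputable def sobolevENorm {d : ℕ} (k : ℕ) (u : TD d) : ℝ≥0∞ :=
  ⨅ (g : Lp ℂ 2 (volume : Measure (Eu d)))
    (_ : TemperedDistribution.besselPotential (Eu d) ℂ (k : ℝ) u = Lp.toTemperedDistribution g),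
    ‖g‖ₑ

/-- `p` is the product `q u` of the tempered distribution `q` with `u ∈ W^{k,2}(ℝ^d)`: the map
`φ ↦ φ q`, from Schwartz functions to tempered distributions, extends by continuity in the norm of
`W^{k,2}(ℝ^d)` to `u`, with the value `p`. The second condition (which holds for every
`u ∈ W^{k,2}(ℝ^d)`) makes `p` unique. -/
def IsProduct {d : ℕ} (k : ℕ) (q u p : TD d) : Prop :=
  (∀ φ : ℕ → 𝓢(Eu d, ℂ),
    Tendsto (fun n => sobolevENorm k ((φ n : TD d) - u)) atTop (𝓝 0) →
    Tendsto (fun n => TemperedDistribution.smulLeftCLM ℂ (φ n) q) atTop (𝓝 p)) ∧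
  ∃ φ : ℕ → 𝓢(Eu d, ℂ), Tendsto (fun n => sobolevENorm k ((φ n : TD d) - u)) atTop (𝓝 0)

theorem IsProduct.unique {d k : ℕ} {q u p p' : TD d} (hp : IsProduct k q u p)
    (hp' : IsProduct k q u p') : p = p' := by
  obtain ⟨φ, hφ⟩ := hp.2
  have h1 := hp.1 φ hφ
  have h2 := hp'.1 φ hφ
  ext v
  exact tendsto_nhds_unique
    (((PointwiseConvergenceCLM.evalCLM (RingHom.id ℂ) ℂ v).continuous.tendsto p).comp h1)
    (((PointwiseConvergenceCLM.evalCLM (RingHom.id ℂ) ℂ v).continuous.tendsto p').comp h2)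

/-- `ψ ∈ W^{m,2}(ℝ^d)` solves, in the sense of distributions on `Ω`, the equation `L_ζ ψ = f`,
where `L_ζ = P_ζ(hD)^m + h^{2m} Q · (ζ/(ih) + D) + h^{2m} q`. -/
def IsSolution {d : ℕ} (Ω : Set (Eu d)) (m : ℕ) (Q : Fin d → TD d) (q : TD d)
    (ζ : Fin d → ℂ) (h : ℝ) (f ψ : TD d) : Prop :=
  TemperedDistribution.MemSobolev (m : ℝ) 2 ψ ∧
  ∃ (R : Fin d → TD d) (r : TD d),
    (∀ j, IsProduct (m - 1) (Q j) ((ζ j / (Complex.I * (h : ℂ))) • ψ + D j ψ) (R j)) ∧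
    IsProduct m q ψ r ∧
    ∀ v : 𝓢(Eu d, ℂ), HasCompactSupport v → tsupport v ⊆ Ω →
      ((opP ζ h)^[m] ψ + ((h : ℂ) ^ (2 * m)) • ∑ j, R j + ((h : ℂ) ^ (2 * m)) • r) v = f v

end Polyharmonic

/-!
The equation is solved by duality on the Fourier side. Let `p(η) = P_ζ(hξ)` at `ξ = 2πη` and
`ω = (h + |p|)^{m/2}`, so that the norm of `u` in `X^{±m/2}` is, up to a constant Jacobian, the `L²`
norm of `ω^{±1} 𝓕u`.

*A priori estimate for the transpose.* Let `v` be a Schwartz function that vanishes outside of the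
bounded set `Ω`, contained in a ball of radius `R`. As `ζ = μ₁ + iμ₂`, the imaginary part of `p` is
`-2h μ₁ · ξ`, and Poincaré's inequality in the direction `μ₁` (`norm_le_mul_norm_lineDeriv`) gives
`‖𝓕⁻v‖ ≤ (R/h) ‖p 𝓕⁻v‖`. Hence the part of `𝓕⁻v` on the set where `|p|` is small compared to `h` is
controlled by the rest, and `‖p^m ω⁻¹ 𝓕⁻v‖ ≥ c ‖ω 𝓕⁻v‖` with `c` independent of `h` and `ζ`
(`exists_apriori`).

*Lower order terms.* For `|β| ≤ m`, `⟨(D^β g) φ, v⟩` is, up to a sign, the integral of `g` against a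
derivative of order `|β|` of `φ v`. Every derivative of `φ` and of `v` up to the order `m` costs a
factor `h⁻¹`, as `|hξ|^n ≤ C h^{-m/2} ω` for `n ≤ m` (`pow_le_xWeight`). Boundedness of `g` alone thus
shows that the lower order terms are bounded from `X^{m/2}` to `X^{-m/2}` uniformly in `h`. The Hölder
continuity provides a small factor: one derivative of `φ v` is replaced by its average over
translates by at most `√h`, with an error of relative size `√h^θ`, and this average is a difference
quotient, which costs only `h^{-1/2}` in place of `h⁻¹` (`norm_integral_lineDeriv_mul_le`). The
result is the factor `√h^θ` in `norm_pertForm_le`, which makes these terms smaller than `c/2` for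
`h ≤ h₀`.

*Duality.* The two estimates show that `v ↦ f v` is bounded by the norm of the functional
`φ ↦ ⟨L_ζ φ, v⟩` on `X^{m/2}`. By the theorem of Hahn and Banach and the reflexivity of `L²` it is
represented by some `G = ω 𝓕ψ` (`exists_tendsto_of_bilinear`, `exists_weak_solution`), with
`‖G‖ ≤ (2/c) ‖ω⁻¹ 𝓕f‖`. As `(1 + |η|²)^{m/2} ≤ C ω` for fixed `h`, `ψ` belongs to `W^{m,2}`, the
products with `Q_j` and `q` exist (`exists_isProduct`), and convergence `ω 𝓕φ_n → G` of Schwartz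
functions entails convergence of all terms of the equation (`exists_isSolution`).
-/

namespace Polyharmonic

/-! ### Distributions with square integrable Fourier transform -/

/-- The tempered distribution `u` has the square integrable Fourier transform `g`, in Mathlib's
normalization: `u v = ∫ g 𝓕⁻v` for all Schwartz functions `v`. -/
def HasHat {d : ℕ} (u : TD d) (g : Eu d → ℂ) : Prop :=
  MemLp g 2 volume ∧ ∀ v : 𝓢(Eu d, ℂ), u v = ∫ η, 𝓕⁻ v η * g η

theorem integrable_schwartz_mul {d : ℕ} {g : Eu d → ℂ} (hg : MemLp g 2 volume)
    (v : 𝓢(Eu d, ℂ)) : Integrable (fun η => v η * g η) :=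
  (v.memLp 2).integrable_mul hg

theorem HasHat.eq_toTemperedDistribution {d : ℕ} {u : TD d} {g : Eu d → ℂ} (hu : HasHat u g) :
    u = Lp.toTemperedDistribution (𝓕⁻ (hu.1.toLp g) : Lp ℂ 2 (volume : Measure (Eu d))) := by
  ext v
  rw [← Lp.fourierInv_toTemperedDistribution_eq, TemperedDistribution.fourierInv_apply,
    Lp.toTemperedDistribution_apply, hu.2 v]
  refine integral_congr_ae ?_
  filter_upwards [hu.1.coeFn_toLp] with x hx
  simp [hx]

theorem exists_hasHat {d : ℕ} {g : Eu d → ℂ} (hg : MemLp g 2 volume) : ∃ u : TD d, HasHat u g := by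
  refine ⟨𝓕⁻ (Lp.toTemperedDistribution (hg.toLp g)), hg, fun v => ?_⟩
  rw [TemperedDistribution.fourierInv_apply, Lp.toTemperedDistribution_apply]
  refine integral_congr_ae ?_
  filter_upwards [hg.coeFn_toLp] with x hx
  simp [hx]

theorem hasHat_schwartz {d : ℕ} (φ : 𝓢(Eu d, ℂ)) : HasHat (φ : TD d) (𝓕 φ : 𝓢(Eu d, ℂ)) := by
  refine ⟨(𝓕 φ).memLp 2, fun v => ?_⟩
  rw [SchwartzMap.coe_apply]
  have := SchwartzMap.integral_fourier_smul_eq (𝓕⁻ v) φ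
  simpa using this

theorem HasHat.congr_ae {d : ℕ} {u : TD d} {g g' : Eu d → ℂ} (hu : HasHat u g)
    (h : g =ᵐ[volume] g') :
    HasHat u g' := by
  refine ⟨hu.1.ae_eq h, fun v => ?_⟩
  rw [hu.2 v]
  refine integral_congr_ae ?_
  filter_upwards [h] with x hx
  rw [hx]

theorem HasHat.add {d : ℕ} {u u' : TD d} {g g' : Eu d → ℂ} (hu : HasHat u g) (hu' : HasHat u' g') :
    HasHat (u + u') (fun η => g η + g' η) := by
  refine ⟨hu.1.add hu'.1, fun v => ?_⟩
  change u v + u' v = _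
  rw [hu.2, hu'.2,
    ← integral_add (integrable_schwartz_mul hu.1 _) (integrable_schwartz_mul hu'.1 _)]
  simp only [mul_add]

theorem HasHat.sub {d : ℕ} {u u' : TD d} {g g' : Eu d → ℂ} (hu : HasHat u g) (hu' : HasHat u' g') :
    HasHat (u - u') (fun η => g η - g' η) := by
  refine ⟨hu.1.sub hu'.1, fun v => ?_⟩
  change u v - u' v = _
  rw [hu.2, hu'.2,
    ← integral_sub (integrable_schwartz_mul hu.1 _) (integrable_schwartz_mul hu'.1 _)]
  simp only [mul_sub]

theorem HasHat.smul {d : ℕ} {u : TD d} {g : Eu d → ℂ} (c : ℂ) (hu : HasHat u g) :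
    HasHat (c • u) (fun η => c * g η) := by
  refine ⟨hu.1.const_mul c, fun v => ?_⟩
  change c • u v = _
  rw [hu.2, smul_eq_mul, ← integral_const_mul]
  congr 1 with η
  ring

theorem fourierInv_lineDeriv_single {d : ℕ} (j : Fin d) (v : 𝓢(Eu d, ℂ)) (η : Eu d) :
    𝓕⁻ (∂_{(EuclideanSpace.single j (1 : ℝ) : Eu d)} v) η
      = -(2 * Real.pi * Complex.I) * (η j : ℂ) * 𝓕⁻ v η := by
  rw [SchwartzMap.fourierInv_lineDerivOp_eq]
  have h : (inner ℝ · (EuclideanSpace.single j (1 : ℝ) : Eu d)).HasTemperateGrowth := by fun_prop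
  change (-(2 * Real.pi * Complex.I) : ℂ) • SchwartzMap.smulLeftCLM ℂ
    (inner ℝ · (EuclideanSpace.single j (1 : ℝ) : Eu d)) (𝓕⁻ v) η = _
  rw [SchwartzMap.smulLeftCLM_apply_apply h]
  simp [EuclideanSpace.inner_single_right]
  ring

theorem fourier_lineDeriv_single {d : ℕ} (j : Fin d) (v : 𝓢(Eu d, ℂ)) (η : Eu d) :
    𝓕 (∂_{(EuclideanSpace.single j (1 : ℝ) : Eu d)} v) η
      = (2 * Real.pi * Complex.I) * (η j : ℂ) * 𝓕 v η := by
  rw [SchwartzMap.fourier_lineDerivOp_eq]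
  have h : (inner ℝ · (EuclideanSpace.single j (1 : ℝ) : Eu d)).HasTemperateGrowth := by fun_prop
  change (2 * Real.pi * Complex.I : ℂ) • SchwartzMap.smulLeftCLM ℂ
    (inner ℝ · (EuclideanSpace.single j (1 : ℝ) : Eu d)) (𝓕 v) η = _
  rw [SchwartzMap.smulLeftCLM_apply_apply h]
  simp [EuclideanSpace.inner_single_right]
  ring

theorem D_apply {d : ℕ} (j : Fin d) (u : TD d) (v : 𝓢(Eu d, ℂ)) :
    D j u v = Complex.I * u (∂_{(EuclideanSpace.single j (1 : ℝ) : Eu d)} v) := by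
  change (-Complex.I) • (u (-∂_{(EuclideanSpace.single j (1 : ℝ) : Eu d)} v)) = _
  simp

theorem HasHat.D {d : ℕ} {u : TD d} {g : Eu d → ℂ} (hu : HasHat u g) (j : Fin d)
    (hg : MemLp (fun η => (2 * Real.pi * η j : ℂ) * g η) 2 volume) :
    HasHat (D j u) (fun η => (2 * Real.pi * η j : ℂ) * g η) := by
  refine ⟨hg, fun v => ?_⟩
  rw [D_apply, hu.2, ← integral_const_mul]
  congr 1 with η
  rw [fourierInv_lineDeriv_single]
  linear_combination (-2 * Real.pi * (η j : ℂ) * 𝓕⁻ v η * g η) * Complex.I_sq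

/-- The weight `(1 + |η|²)^{k/2}` of the Bessel potential norm. -/
noncomputable def besselWeight {d : ℕ} (k : ℕ) (η : Eu d) : ℝ := (1 + ‖η‖ ^ 2) ^ ((k : ℝ) / 2)

theorem HasHat.bessel_apply {d : ℕ} {u : TD d} {g : Eu d → ℂ} (hu : HasHat u g) (k : ℕ)
    (v : 𝓢(Eu d, ℂ)) : TemperedDistribution.besselPotential (Eu d) ℂ (k : ℝ) u v
      = ∫ η, 𝓕⁻ v η * ((besselWeight k η : ℂ) * g η) := by
  rw [TemperedDistribution.besselPotential, TemperedDistribution.fourierMultiplierCLM_apply_apply,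
    hu.2]
  have h : (fun x : Eu d => (((1 + ‖x‖ ^ 2) ^ ((k : ℝ) / 2) : ℝ) : ℂ)).HasTemperateGrowth := by
    fun_prop
  congr 1 with η
  simp only [FourierTransform.fourierInv_fourier_eq]
  rw [SchwartzMap.smulLeftCLM_apply_apply h, besselWeight, smul_eq_mul]
  ring

theorem HasHat.bessel {d k : ℕ} {u : TD d} {g : Eu d → ℂ} (hu : HasHat u g)
    (hg : MemLp (fun η => (besselWeight k η : ℂ) * g η) 2 volume) :
    HasHat (TemperedDistribution.besselPotential (Eu d) ℂ (k : ℝ) u)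
      (fun η => (besselWeight k η : ℂ) * g η) :=
  ⟨hg, hu.bessel_apply k⟩

theorem HasHat.memSobolev {d k : ℕ} {u : TD d} {g : Eu d → ℂ} (hu : HasHat u g)
    (hg : MemLp (fun η => (besselWeight k η : ℂ) * g η) 2 volume) :
    TemperedDistribution.MemSobolev (k : ℝ) 2 u :=
  ⟨_, (hu.bessel hg).eq_toTemperedDistribution⟩

theorem toTemperedDistribution_injective {d : ℕ} {f g : Lp ℂ 2 (volume : Measure (Eu d))}
    (h : Lp.toTemperedDistribution f = Lp.toTemperedDistribution g) : f = g := by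
  have := Lp.ker_toTemperedDistributionCLM_eq_bot (F := ℂ) (μ := (volume : Measure (Eu d))) (p := 2)
  exact LinearMap.ker_eq_bot.1 this (by simpa using h)

theorem HasHat.sobolevENorm_eq {d k : ℕ} {u : TD d} {g : Eu d → ℂ} (hu : HasHat u g)
    (hg : MemLp (fun η => (besselWeight k η : ℂ) * g η) 2 volume) :
    sobolevENorm k u = eLpNorm (fun η => (besselWeight k η : ℂ) * g η) 2 volume := by
  have h := (hu.bessel hg).eq_toTemperedDistribution
  have hn : ‖(𝓕⁻ ((hu.bessel hg).1.toLp _) : Lp ℂ 2 (volume : Measure (Eu d)))‖ₑ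
      = eLpNorm (fun η => (besselWeight k η : ℂ) * g η) 2 volume := by
    rw [← Lp.enorm_toLp (f := (fun η => (besselWeight k η : ℂ) * g η)) hg]
    rw [← ofReal_norm, ← ofReal_norm,
      ← Lp.norm_fourier_eq (𝓕⁻ ((hu.bessel hg).1.toLp _) : Lp ℂ 2 (volume : Measure (Eu d))),
      FourierTransform.fourier_fourierInv_eq]
  refine le_antisymm ((iInf₂_le (𝓕⁻ ((hu.bessel hg).1.toLp _) : Lp ℂ 2 (volume : Measure (Eu d)))
    h).trans hn.le) (le_iInf₂ fun f hf => ?_)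
  rw [← hn, toTemperedDistribution_injective (hf.symm.trans h)]

theorem HasHat.isFunction {d : ℕ} {u : TD d} {g : Eu d → ℂ} (hu : HasHat u g) :
    IsFunction (𝓕 u) g := by
  refine ⟨hu.1.locallyIntegrable (by norm_num), fun v _ => ?_⟩
  rw [TemperedDistribution.fourier_apply, hu.2]
  simp

end Polyharmonic

namespace Polyharmonic

/-! ### Weighted square integrable functions -/

/-- A continuous weight on the frequency space that is bounded below by a positive constant and
above by a power of `1 + |η|²`. -/
structure IsWeight {d : ℕ} (ω : Eu d → ℝ) : Prop where
  continuous : Continuous ω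
  exists_le : ∃ c > 0, ∀ η, c ≤ ω η
  exists_ge : ∃ (C : ℝ) (N : ℕ), ∀ η, ω η ≤ C * besselWeight N η

theorem besselWeight_pos {d : ℕ} (k : ℕ) (η : Eu d) : 0 < besselWeight k η := by
  unfold besselWeight; positivity

theorem one_le_besselWeight {d : ℕ} (k : ℕ) (η : Eu d) : 1 ≤ besselWeight k η :=
  Real.one_le_rpow (by nlinarith [sq_nonneg ‖η‖]) (by positivity)

theorem continuous_besselWeight {d : ℕ} (k : ℕ) : Continuous (besselWeight (d := d) k) := by
  unfold besselWeight
  exact (by fun_prop : Continuous fun η : Eu d => 1 + ‖η‖ ^ 2).rpow_const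
    fun η => Or.inr (by positivity)

theorem isWeight_besselWeight {d : ℕ} (k : ℕ) : IsWeight (besselWeight (d := d) k) :=
  ⟨continuous_besselWeight k, ⟨1, one_pos, one_le_besselWeight k⟩, 1, k, fun η => by simp⟩

theorem IsWeight.pos {d : ℕ} {ω : Eu d → ℝ} (hω : IsWeight ω) (η : Eu d) : 0 < ω η := by
  obtain ⟨c, hc, h⟩ := hω.exists_le
  exact hc.trans_le (h η)

theorem IsWeight.memLp {d : ℕ} {ω : Eu d → ℝ} (hω : IsWeight ω) (φ : 𝓢(Eu d, ℂ)) :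
    MemLp (fun η => (ω η : ℂ) * φ η) 2 volume := by
  obtain ⟨C, N, h⟩ := hω.exists_ge
  have hN : (fun x : Eu d => (((1 + ‖x‖ ^ 2) ^ ((N : ℝ) / 2) : ℝ) : ℂ)).HasTemperateGrowth := by
    fun_prop
  refine MemLp.of_le_mul (c := C) ((SchwartzMap.smulLeftCLM ℂ
    (fun x : Eu d => (((1 + ‖x‖ ^ 2) ^ ((N : ℝ) / 2) : ℝ) : ℂ)) φ).memLp 2) ?_ ?_
  · have := hω.continuous
    have h2 : Continuous φ := φ.continuous
    exact (by fun_prop : Continuous fun η => (ω η : ℂ) * φ η).aestronglyMeasurable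
  · refine Eventually.of_forall fun η => ?_
    rw [SchwartzMap.smulLeftCLM_apply_apply hN, norm_mul, norm_smul, Complex.norm_real,
      Complex.norm_real, Real.norm_of_nonneg (hω.pos η).le,
      Real.norm_of_nonneg (by positivity : (0 : ℝ) ≤ (1 + ‖η‖ ^ 2) ^ ((N : ℝ) / 2)), ← mul_assoc]
    exact mul_le_mul_of_nonneg_right (h η) (norm_nonneg _)

/-- Multiplication of Schwartz functions by a weight, with values in `L²`. -/
noncomputable def weightMul {d : ℕ} {ω : Eu d → ℝ} (hω : IsWeight ω) :
    𝓢(Eu d, ℂ) →ₗ[ℂ] Lp ℂ 2 (volume : Measure (Eu d)) where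
  toFun φ := (hω.memLp φ).toLp _
  map_add' φ ψ := by
    rw [← MemLp.toLp_add]
    congr 1
    ext η
    simp [mul_add]
  map_smul' c φ := by
    rw [RingHom.id_apply, ← MemLp.toLp_const_smul]
    congr 1
    ext η
    simp
    ring

theorem coeFn_weightMul {d : ℕ} {ω : Eu d → ℝ} (hω : IsWeight ω) (φ : 𝓢(Eu d, ℂ)) :
    weightMul hω φ =ᵐ[volume] fun η => (ω η : ℂ) * φ η :=
  (hω.memLp φ).coeFn_toLp

/-- A square integrable `K` orthogonal to all `ω φ` vanishes: `ω K` is locally integrable and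
orthogonal to all test functions. -/
theorem denseRange_weightMul {d : ℕ} {ω : Eu d → ℝ} (hω : IsWeight ω) :
    DenseRange (weightMul hω) := by
  have key : (LinearMap.range (weightMul hω))ᗮ = ⊥ := by
    rw [Submodule.eq_bot_iff]
    intro K hK
    rw [Submodule.mem_orthogonal] at hK
    have hloc : LocallyIntegrable (fun η => (ω η : ℂ) * K η) :=
      ((Lp.memLp K).locallyIntegrable (by norm_num)).continuous_mul
        (Complex.continuous_ofReal.comp hω.continuous)
    have h0 := ae_eq_zero_of_integral_contDiff_smul_eq_zero hloc (fun g hg hgs => by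
      have hg₁ : HasCompactSupport (Complex.ofRealCLM ∘ g) := hgs.comp_left rfl
      have hg₂ : ContDiff ℝ ((⊤ : ℕ∞) : WithTop ℕ∞) (Complex.ofRealCLM ∘ g) := by fun_prop
      have := hK _ ⟨hg₁.toSchwartzMap hg₂, rfl⟩
      rw [L2.inner_def] at this
      rw [← this]
      refine integral_congr_ae ?_
      filter_upwards [coeFn_weightMul hω (hg₁.toSchwartzMap hg₂)] with η hη
      rw [hη]
      simp
      ring)
    rw [Lp.eq_zero_iff_ae_eq_zero]
    filter_upwards [h0] with η hη
    have := (hω.pos η).ne'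
    simpa [this] using hη
  have h := Submodule.topologicalClosure_eq_top_iff.2 key
  exact (Submodule.dense_iff_topologicalClosure_eq_top (s := LinearMap.range (weightMul hω))).2 h

/-- The norm of `k` in `L²` can be tested on the dense subspace of the functions `ω φ`. -/
theorem norm_le_of_forall_weightMul {d : ℕ} {ω : Eu d → ℝ} (hω : IsWeight ω) {k : Eu d → ℂ}
    (hk : MemLp k 2 volume) {C : ℝ} (hC : 0 ≤ C)
    (h : ∀ φ : 𝓢(Eu d, ℂ), ‖∫ η, (ω η : ℂ) * φ η * k η‖ ≤ C * ‖weightMul hω φ‖) :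
    ‖hk.toLp k‖ ≤ C := by
  set k' : Lp ℂ 2 (volume : Measure (Eu d)) := hk.star.toLp (star k) with hk'
  have hnorm : ‖hk.toLp k‖ = ‖k'‖ := by
    rw [Lp.norm_toLp, hk', Lp.norm_toLp]
    congr 1
    exact eLpNorm_congr_norm_ae (Eventually.of_forall fun x => by simp)
  have hall : ∀ g : Lp ℂ 2 (volume : Measure (Eu d)), ‖inner ℂ k' g‖ ≤ C * ‖g‖ := by
    refine fun g => (denseRange_weightMul hω).induction_on
      (p := fun g => ‖inner ℂ k' g‖ ≤ C * ‖g‖) g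
      (isClosed_le (by fun_prop) (by fun_prop)) fun φ => ?_
    refine le_trans (le_of_eq ?_) (h φ)
    rw [L2.inner_def]
    congr 1
    refine integral_congr_ae ?_
    filter_upwards [coeFn_weightMul hω φ, hk.star.coeFn_toLp] with η hη hη'
    rw [hη, hk', hη']
    simp
  have := hall k'
  rw [inner_self_eq_norm_sq_to_K] at this
  rw [hnorm]
  rcases (norm_nonneg k').eq_or_lt with h0 | h0
  · rwa [← h0]
  · have h2 : ‖k'‖ * ‖k'‖ ≤ C * ‖k'‖ := by
      simpa [sq] using this
    exact le_of_mul_le_mul_right h2 h0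

/-- Solvability by duality. Let `A v` be functionals on `E` that are bounded in the norm of `e φ`,
and let `Λ` be a functional on `V` bounded by `K` times the norm of `A v`. Then `Λ v = A v G` for all
`v` and some `G` in the completion `H` of `E`, with `‖G‖ ≤ K`: by the theorem of Hahn and Banach, the
functional `A v ↦ Λ v` extends to the dual of `H`. The value `A v G` is expressed as a limit. -/
theorem exists_tendsto_of_bilinear {H E V : Type*} [NormedAddCommGroup H] [InnerProductSpace ℂ H]
    [CompleteSpace H] [AddCommGroup E] [Module ℂ E] [AddCommGroup V] [Module ℂ V]
    (e : E →ₗ[ℂ] H) (he : DenseRange e) (A : V →ₗ[ℂ] E →ₗ[ℂ] ℂ)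
    (hA : ∀ v, ∃ C, ∀ φ, ‖A v φ‖ ≤ C * ‖e φ‖) (Λ : V →ₗ[ℂ] ℂ) {K : ℝ} (hK : 0 ≤ K)
    (hΛ : ∀ v C, 0 ≤ C → (∀ φ, ‖A v φ‖ ≤ C * ‖e φ‖) → ‖Λ v‖ ≤ K * C) :
    ∃ G : H, ‖G‖ ≤ K ∧ ∀ (v : V) (φ : ℕ → E), Tendsto (fun n => e (φ n)) atTop (𝓝 G) →
      Tendsto (fun n => A v (φ n)) atTop (𝓝 (Λ v)) := by
  have hext : ∀ v φ, (A v).extendOfNorm e (e φ) = A v φ := fun v φ =>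
    LinearMap.extendOfNorm_eq he (hA v) φ
  let T : V →ₗ[ℂ] StrongDual ℂ H :=
    { toFun := fun v => (A v).extendOfNorm e
      map_add' := fun v v' => by
        obtain ⟨C, hC⟩ := hA (v + v')
        refine LinearMap.extendOfNorm_unique he C hC _ ?_
        ext φ
        simp [hext]
      map_smul' := fun c v => by
        obtain ⟨C, hC⟩ := hA (c • v)
        refine LinearMap.extendOfNorm_unique he C hC _ ?_
        ext φ
        simp [hext] }
  have hT : ∀ v φ, T v (e φ) = A v φ := hext
  have hbd : ∀ v, ‖Λ v‖ ≤ K * ‖T v‖ := fun v =>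
    hΛ v _ (norm_nonneg _) fun φ => by rw [← hT]; exact (T v).le_opNorm _
  obtain ⟨Ψ, hΨ, hΨn⟩ := exists_extension_norm_eq (𝕜 := ℂ) (LinearMap.range T)
    (Λ.compLeftInverse T)
  have hval : ∀ v, Ψ (T v) = Λ v := fun v => by
    rw [hΨ ⟨T v, LinearMap.mem_range_self T v⟩]
    exact LinearMap.compLeftInverse_apply_of_bdd _ _ ⟨K, hbd⟩ _ _ rfl
  have hn : ‖Ψ‖ ≤ K := by
    rw [hΨn]
    refine ContinuousLinearMap.opNorm_le_bound _ hK ?_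
    rintro ⟨_, v, rfl⟩
    rw [LinearMap.compLeftInverse_apply_of_bdd _ _ ⟨K, hbd⟩ v _ rfl]
    exact hbd v
  -- By reflexivity of the Hilbert space `H`, the functional `Ψ` is the evaluation at some `G`.
  let F : H →ₗ[ℂ] ℂ :=
    { toFun := fun x => starRingEnd ℂ (Ψ (InnerProductSpace.toDual ℂ H x))
      map_add' := fun x y => by simp
      map_smul' := fun c x => by rw [map_smulₛₗ, map_smul]; simp }
  have hF : ∀ x, ‖F x‖ ≤ K * ‖x‖ := fun x => by
    have := Ψ.le_of_opNorm_le hn (InnerProductSpace.toDual ℂ H x)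
    simpa [F] using this
  set G : H := (InnerProductSpace.toDual ℂ H).symm (F.mkContinuous K hF) with hG
  have hΨG : ∀ L : StrongDual ℂ H, Ψ L = L G := fun L => by
    obtain ⟨x, rfl⟩ := (InnerProductSpace.toDual ℂ H).surjective L
    have h1 : inner ℂ G x = F x := by
      rw [hG, InnerProductSpace.toDual_symm_apply, LinearMap.mkContinuous_apply]
    rw [InnerProductSpace.toDual_apply_apply, ← inner_conj_symm, h1]
    simp [F]
  refine ⟨G, ?_, fun v φ hφ => ?_⟩
  · rw [hG, LinearIsometryEquiv.norm_map]
    exact LinearMap.mkContinuous_norm_le _ hK _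
  · rw [← hval, hΨG]
    simp only [← hT]
    exact ((T v).continuous.tendsto G).comp hφ

end Polyharmonic

namespace Polyharmonic

/-! ### Compactly supported test functions -/

/-- Compactly supported Schwartz functions are dense, by cutoffs `b (x / (n + 1))`: on the set where
the cutoff differs from `1`, the factor `‖x‖ / (n + 1) ≥ 1` turns one power of `‖x‖` in the
seminorm into the decay `1 / (n + 1)`. -/
theorem exists_hasCompactSupport_tendsto {d : ℕ} (v : 𝓢(Eu d, ℂ)) :
    ∃ w : ℕ → 𝓢(Eu d, ℂ), (∀ n, HasCompactSupport (w n)) ∧ Tendsto w atTop (𝓝 v) := by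
  let b : ContDiffBump (0 : Eu d) := ⟨1, 2, one_pos, one_lt_two⟩
  have hb₁ : HasCompactSupport (Complex.ofRealCLM ∘ b) := b.hasCompactSupport.comp_left rfl
  have hb₂ : ContDiff ℝ ((⊤ : ℕ∞) : WithTop ℕ∞) (Complex.ofRealCLM ∘ b) :=
    Complex.ofRealCLM.contDiff.comp b.contDiff
  let X : 𝓢(Eu d, ℂ) := hb₁.toSchwartzMap hb₂
  have hX : ∀ x, X x = b x := fun x => rfl
  let L : ℕ → Eu d →L[ℝ] Eu d := fun n => ((n + 1 : ℝ)⁻¹) • ContinuousLinearMap.id ℝ (Eu d)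
  have hL : ∀ n x, L n x = (n + 1 : ℝ)⁻¹ • x := fun n x => rfl
  have hLn : ∀ n, ‖L n‖ ≤ 1 := fun n => by
    refine ContinuousLinearMap.opNorm_le_bound _ zero_le_one fun x => ?_
    rw [hL, norm_smul, Real.norm_of_nonneg (by positivity)]
    refine mul_le_mul_of_nonneg_right ?_ (norm_nonneg x)
    exact inv_le_one_of_one_le₀ (by linarith [n.cast_nonneg (α := ℝ)])
  have hcs : ∀ n, HasCompactSupport (X ∘ L n) := fun n => by
    refine hb₁.comp_homeomorph (Homeomorph.smulOfNeZero ((n + 1 : ℝ)⁻¹) (by positivity))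
  have hcd : ∀ n, ContDiff ℝ ((⊤ : ℕ∞) : WithTop ℕ∞) (X ∘ L n) := fun n =>
    (X.smooth _).comp (L n).contDiff
  have hg : ∀ n, (X ∘ L n).HasTemperateGrowth := fun n => (hcs n).hasTemperateGrowth (hcd n)
  let w : ℕ → 𝓢(Eu d, ℂ) := fun n => SchwartzMap.smulLeftCLM ℂ (X ∘ L n) v
  have hw : ∀ n x, w n x = X (L n x) * v x := fun n x => by
    simp only [w]
    rw [SchwartzMap.smulLeftCLM_apply_apply (hg n)]
    rfl
  have hwfun : ∀ n, (w n : Eu d → ℂ) = fun x => (X ∘ L n) x * v x := fun n => funext (hw n)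
  refine ⟨w, fun n => ?_, ?_⟩
  · rw [hwfun]
    exact (hcs n).mul_right
  rw [(schwartz_withSeminorms ℂ (Eu d) ℂ).tendsto_nhds_atTop _ _]
  rintro ⟨k, j⟩ ε hε
  -- `S` dominates `|x|^{k+1} |D^j (w n)|` and `|x|^{k+1} |D^j v|` for all `n`.
  set S : ℝ := ∑ i ∈ Finset.range (j + 1), (j.choose i : ℝ) * SchwartzMap.seminorm ℂ 0 i X *
    SchwartzMap.seminorm ℂ (k + 1) (j - i) v + SchwartzMap.seminorm ℂ (k + 1) j v with hS
  have hS0 : 0 ≤ S := by positivity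
  have hbound : ∀ n x, ‖x‖ ^ (k + 1) * ‖iteratedFDeriv ℝ j (w n - v) x‖ ≤ S := fun n x => by
    have h1 : iteratedFDeriv ℝ j (w n - v) x = iteratedFDeriv ℝ j (w n) x - iteratedFDeriv ℝ j v x := by
      have : ((w n - v : 𝓢(Eu d, ℂ)) : Eu d → ℂ) = (w n : Eu d → ℂ) - v := by ext; simp
      rw [this, iteratedFDeriv_sub ((w n).smooth j) (v.smooth j), Pi.sub_apply]
    have h2 : ‖iteratedFDeriv ℝ j (w n) x‖ ≤ ∑ i ∈ Finset.range (j + 1),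
        (j.choose i : ℝ) * SchwartzMap.seminorm ℂ 0 i X * ‖iteratedFDeriv ℝ (j - i) v x‖ := by
      rw [hwfun]
      refine (norm_iteratedFDeriv_mul_le (hcd n) (v.smooth ⊤) x (n := j)
        (by exact_mod_cast le_top)).trans ?_
      refine Finset.sum_le_sum fun i _ => ?_
      refine mul_le_mul_of_nonneg_right (mul_le_mul_of_nonneg_left ?_ (by positivity))
        (norm_nonneg _)
      rw [(L n).iteratedFDeriv_comp_right (X.smooth ⊤) x (by exact_mod_cast le_top)]
      refine (ContinuousMultilinearMap.norm_compContinuousLinearMap_le _ _).trans ?_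
      rw [Finset.prod_const]
      refine (mul_le_of_le_one_right (norm_nonneg _)
        (pow_le_one₀ (norm_nonneg _) (hLn n))).trans ?_
      exact X.norm_iteratedFDeriv_le_seminorm ℂ i _
    rw [h1]
    calc ‖x‖ ^ (k + 1) * ‖iteratedFDeriv ℝ j (w n) x - iteratedFDeriv ℝ j v x‖
        ≤ ‖x‖ ^ (k + 1) * (∑ i ∈ Finset.range (j + 1), (j.choose i : ℝ) *
          SchwartzMap.seminorm ℂ 0 i X * ‖iteratedFDeriv ℝ (j - i) v x‖
          + ‖iteratedFDeriv ℝ j v x‖) := by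
          gcongr
          exact (norm_sub_le _ _).trans (by gcongr)
      _ ≤ S := by
          rw [mul_add, Finset.mul_sum, hS]
          refine add_le_add (Finset.sum_le_sum fun i _ => ?_) (v.le_seminorm ℂ _ _ x)
          have := v.le_seminorm ℂ (k + 1) (j - i) x
          calc _ = (j.choose i : ℝ) * SchwartzMap.seminorm ℂ 0 i X *
                (‖x‖ ^ (k + 1) * ‖iteratedFDeriv ℝ (j - i) v x‖) := by ring
            _ ≤ _ := by gcongr
  obtain ⟨N, hN⟩ := exists_nat_gt (S / ε)
  refine ⟨N, fun n hn => ?_⟩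
  have hnp : (0 : ℝ) < n + 1 := by positivity
  refine lt_of_le_of_lt (SchwartzMap.seminorm_le_bound ℂ k j _ (M := S / (n + 1)) (by positivity)
    fun x => ?_) ?_
  · rcases lt_or_ge ‖x‖ (n + 1) with hx | hx
    · have hz : (w n - v : 𝓢(Eu d, ℂ)) =ᶠ[𝓝 x] (fun _ => (0 : ℂ)) := by
        have : ∀ᶠ y in 𝓝 x, ‖y‖ < n + 1 := continuous_norm.continuousAt.eventually_lt_const hx
        filter_upwards [this] with y hy
        have h1 : b (L n y) = 1 := b.one_of_mem_closedBall (by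
          rw [mem_closedBall_zero_iff, hL, norm_smul, Real.norm_of_nonneg (by positivity),
            inv_mul_le_iff₀ hnp, mul_one]
          exact hy.le)
        simp [hw, hX, h1]
      rw [(hz.iteratedFDeriv ℝ j).eq_of_nhds]
      simp only [iteratedFDeriv_fun_zero, Pi.zero_apply, norm_zero, mul_zero]
      positivity
    · rw [le_div_iff₀ hnp]
      refine le_trans ?_ (hbound n x)
      rw [pow_succ]
      calc _ = ‖x‖ ^ k * ‖iteratedFDeriv ℝ j (w n - v) x‖ * (n + 1) := rfl
        _ ≤ ‖x‖ ^ k * ‖iteratedFDeriv ℝ j (w n - v) x‖ * ‖x‖ := by gcongr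
        _ = _ := by ring
  · rw [div_lt_iff₀ hnp]
    rw [div_lt_iff₀ hε] at hN
    have : (N : ℝ) ≤ n := by exact_mod_cast hn
    nlinarith

theorem eq_of_forall_hasCompactSupport {d : ℕ} {S T : TD d}
    (h : ∀ v : 𝓢(Eu d, ℂ), HasCompactSupport v → S v = T v) : S = T := by
  ext v
  obtain ⟨w, hw, hwv⟩ := exists_hasCompactSupport_tendsto v
  refine tendsto_nhds_unique ((S.continuous.tendsto v).comp hwv) ?_
  exact ((T.continuous.tendsto v).comp hwv).congr fun n => (h _ (hw n)).symm

theorem sq_norm_toLp {d : ℕ} {f : Eu d → ℂ} (hf : MemLp f 2 volume) :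
    ‖hf.toLp f‖ ^ 2 = ∫ x, ‖f x‖ ^ 2 := by
  rw [Lp.norm_toLp, hf.eLpNorm_eq_integral_rpow_norm (by norm_num) (by norm_num),
    ENNReal.toReal_ofReal (by positivity)]
  simp only [ENNReal.toReal_ofNat, Real.rpow_ofNat]
  rw [← one_div, ← Real.sqrt_eq_rpow, Real.sq_sqrt (by positivity)]

theorem norm_toLp_two_sq {d : ℕ} (v : 𝓢(Eu d, ℂ)) :
    ‖(v.toLp 2 : Lp ℂ 2 (volume : Measure (Eu d)))‖ ^ 2 = ∫ x, ‖v x‖ ^ 2 :=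
  sq_norm_toLp (v.memLp 2)

theorem integral_norm_mul_norm_le {d : ℕ} (v w : 𝓢(Eu d, ℂ)) :
    ∫ x, ‖v x‖ * ‖w x‖ ≤ ‖(v.toLp 2 : Lp ℂ 2 (volume : Measure (Eu d)))‖ *
      ‖(w.toLp 2 : Lp ℂ 2 (volume : Measure (Eu d)))‖ := by
  have h := integral_mul_norm_le_Lp_mul_Lq (μ := (volume : Measure (Eu d))) (f := v) (g := w)
    Real.HolderConjugate.two_two (by simpa using v.memLp 2) (by simpa using w.memLp 2)
  rw [SchwartzMap.norm_toLp' (by norm_num) (by norm_num),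
    SchwartzMap.norm_toLp' (by norm_num) (by norm_num)]
  simpa using h

/-- Poincaré's inequality in the direction `μ`, from the commutator `[∂_μ, x · μ] = 1`:
`‖v‖² = -2 ∫ (x · μ) Re ⟨v, ∂_μ v⟩`. -/
theorem norm_le_mul_norm_lineDeriv {d : ℕ} {R : ℝ} (hR : 0 ≤ R) (μ : Eu d) (hμ : ‖μ‖ = 1)
    (v : 𝓢(Eu d, ℂ)) (hv : ∀ x, v x ≠ 0 → ‖x‖ ≤ R) :
    ‖(v.toLp 2 : Lp ℂ 2 (volume : Measure (Eu d)))‖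
      ≤ 2 * R * ‖((∂_{μ} v : 𝓢(Eu d, ℂ)).toLp 2 : Lp ℂ 2 (volume : Measure (Eu d)))‖ := by
  have hμt : (inner ℝ · μ : Eu d → ℝ).HasTemperateGrowth := by fun_prop
  set f : 𝓢(Eu d, ℂ) := SchwartzMap.smulLeftCLM ℂ (inner ℝ · μ) v with hf
  have hfx : ∀ x, f x = (inner ℝ x μ : ℝ) • v x := fun x =>
    SchwartzMap.smulLeftCLM_apply_apply hμt v x
  have hdf : ∀ x, (∂_{μ} f : 𝓢(Eu d, ℂ)) x = v x + (inner ℝ x μ : ℝ) • (∂_{μ} v : 𝓢(Eu d, ℂ)) x := by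
    intro x
    rw [SchwartzMap.lineDerivOp_apply_eq_fderiv, SchwartzMap.lineDerivOp_apply_eq_fderiv]
    have : (f : Eu d → ℂ) = fun x => (inner ℝ x μ : ℝ) • v x := funext hfx
    rw [this, fderiv_fun_smul (differentiableAt_fun_id.inner ℝ (differentiableAt_const μ))
      v.differentiableAt]
    have h2 : fderiv ℝ (fun x : Eu d => inner ℝ x μ) x μ = 1 := by
      rw [fderiv_inner_apply ℝ differentiableAt_fun_id (differentiableAt_const μ)]
      simp [hμ]
    simp [h2, add_comm]
  have hparts := SchwartzMap.integral_bilinear_lineDerivOp_right_eq_neg_left (μ := volume) f v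
    (innerSL ℝ : ℂ →L[ℝ] ℂ →L[ℝ] ℝ) μ
  set w : 𝓢(Eu d, ℂ) := ∂_{μ} v with hw
  have hL : ∀ x y : ℂ, (innerSL ℝ : ℂ →L[ℝ] ℂ →L[ℝ] ℝ) x y = inner ℝ x y := fun _ _ => rfl
  simp only [hL, hfx, hdf, inner_add_left, real_inner_smul_left,
    real_inner_self_eq_norm_sq] at hparts
  have hi2 : Integrable (fun x => ‖v x‖ * ‖w x‖) :=
    (v.memLp 2).norm.integrable_mul (w.memLp 2).norm
  have hi1 : Integrable (fun x => ‖v x‖ ^ 2) := (v.memLp 2).integrable_norm_pow (by norm_num)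
  have hs : ∀ x, |inner ℝ x μ * inner ℝ (v x) (w x)| ≤ R * (‖v x‖ * ‖w x‖) := fun x => by
    by_cases hx : v x = 0
    · simp [hx]
    · rw [abs_mul]
      refine mul_le_mul ?_ (abs_real_inner_le_norm _ _) (abs_nonneg _) hR
      exact (abs_real_inner_le_norm _ _).trans (by rw [hμ, mul_one]; exact hv x hx)
  have hi3 : Integrable (fun x => inner ℝ x μ * inner ℝ (v x) (w x)) := by
    refine (hi2.const_mul R).mono' ?_ (Eventually.of_forall hs)
    have := v.continuous
    have := w.continuous
    exact ((continuous_id.inner continuous_const).mul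
      (v.continuous.inner w.continuous)).aestronglyMeasurable
  have hcomm : ∀ x, inner ℝ (w x) (v x) = inner ℝ (v x) (w x) := fun x => real_inner_comm _ _
  have hi4 : Integrable (fun x => inner ℝ x μ * inner ℝ (w x) (v x)) := by
    simpa only [hcomm] using hi3
  rw [integral_add hi1 hi4] at hparts
  have hswap : ∫ x, inner ℝ x μ * inner ℝ (w x) (v x) = ∫ x, inner ℝ x μ * inner ℝ (v x) (w x) := by
    simp only [hcomm]
  rw [hswap] at hparts
  have habs : |∫ x, inner ℝ x μ * inner ℝ (v x) (w x)| ≤ R * ∫ x, ‖v x‖ * ‖w x‖ := by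
    rw [← integral_const_mul, ← Real.norm_eq_abs]
    exact norm_integral_le_of_norm_le (hi2.const_mul R) (Eventually.of_forall hs)
  have hCS := integral_norm_mul_norm_le v w
  have hsq := norm_toLp_two_sq v
  set a := ‖(v.toLp 2 : Lp ℂ 2 (volume : Measure (Eu d)))‖ with ha
  set c := ‖(w.toLp 2 : Lp ℂ 2 (volume : Measure (Eu d)))‖ with hc
  have ha0 : 0 ≤ a := norm_nonneg _
  have hc0 : 0 ≤ c := norm_nonneg _
  have hfin : a * a ≤ 2 * R * c * a := by
    have := mul_le_mul_of_nonneg_left hCS hR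
    nlinarith [(abs_le.1 habs).1]
  rcases ha0.eq_or_lt with h0 | h0
  · rw [← h0]; positivity
  · exact le_of_mul_le_mul_right hfin h0

end Polyharmonic

namespace Polyharmonic

/-! ### Iterated derivatives of products -/

/-- The iterated partial derivative `∂_{j_n} ⋯ ∂_{j_1} F` for `l = [j_1, …, j_n]`. -/
noncomputable def iterDeriv {d : ℕ} (l : List (Fin d)) (F : 𝓢(Eu d, ℂ)) : 𝓢(Eu d, ℂ) :=
  l.foldl (fun w j => ∂_{(EuclideanSpace.single j (1 : ℝ) : Eu d)} w) F

theorem iterDeriv_cons {d : ℕ} (j : Fin d) (l : List (Fin d)) (F : 𝓢(Eu d, ℂ)) :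
    iterDeriv (j :: l) F = iterDeriv l (∂_{(EuclideanSpace.single j (1 : ℝ) : Eu d)} F) := rfl

theorem iterDeriv_append {d : ℕ} (l l' : List (Fin d)) (F : 𝓢(Eu d, ℂ)) :
    iterDeriv (l ++ l') F = iterDeriv l' (iterDeriv l F) := List.foldl_append

theorem iterDeriv_add {d : ℕ} (l : List (Fin d)) (F G : 𝓢(Eu d, ℂ)) :
    iterDeriv l (F + G) = iterDeriv l F + iterDeriv l G := by
  induction l generalizing F G with
  | nil => rfl
  | cons j l ih => rw [iterDeriv_cons, lineDerivOp_add, ih]; rfl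

theorem iterDeriv_smul {d : ℕ} (l : List (Fin d)) (c : ℂ) (F : 𝓢(Eu d, ℂ)) :
    iterDeriv l (c • F) = c • iterDeriv l F := by
  induction l generalizing F with
  | nil => rfl
  | cons j l ih => rw [iterDeriv_cons, lineDerivOp_smul, ih]; rfl

theorem abs_apply_le_norm {d : ℕ} (η : Eu d) (j : Fin d) : |η j| ≤ ‖η‖ := by
  simpa using PiLp.norm_apply_le η j

theorem norm_fourier_iterDeriv_le {d : ℕ} (l : List (Fin d)) (F : 𝓢(Eu d, ℂ)) (η : Eu d) :
    ‖𝓕 (iterDeriv l F) η‖ ≤ (2 * Real.pi * ‖η‖) ^ l.length * ‖𝓕 F η‖ := by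
  induction l generalizing F with
  | nil => simp [iterDeriv]
  | cons j l ih =>
    rw [iterDeriv_cons]
    refine (ih _).trans ?_
    rw [fourier_lineDeriv_single, List.length_cons, pow_succ, mul_assoc (_ ^ _), norm_mul]
    refine mul_le_mul_of_nonneg_left (mul_le_mul_of_nonneg_right ?_ (norm_nonneg _)) (by positivity)
    simp only [norm_mul, Complex.norm_ofNat, Complex.norm_real, Complex.norm_I, mul_one,
      Real.norm_eq_abs, abs_of_pos Real.pi_pos]
    exact mul_le_mul_of_nonneg_left (abs_apply_le_norm η j) (by positivity)

theorem norm_fourierInv_iterDeriv_le {d : ℕ} (l : List (Fin d)) (F : 𝓢(Eu d, ℂ)) (η : Eu d) :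
    ‖𝓕⁻ (iterDeriv l F) η‖ ≤ (2 * Real.pi * ‖η‖) ^ l.length * ‖𝓕⁻ F η‖ := by
  induction l generalizing F with
  | nil => simp [iterDeriv]
  | cons j l ih =>
    rw [iterDeriv_cons]
    refine (ih _).trans ?_
    rw [fourierInv_lineDeriv_single, List.length_cons, pow_succ, mul_assoc (_ ^ _), norm_mul]
    refine mul_le_mul_of_nonneg_left (mul_le_mul_of_nonneg_right ?_ (norm_nonneg _)) (by positivity)
    simp only [norm_mul, norm_neg, Complex.norm_ofNat, Complex.norm_real, Complex.norm_I, mul_one,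
      Real.norm_eq_abs, abs_of_pos Real.pi_pos]
    exact mul_le_mul_of_nonneg_left (abs_apply_le_norm η j) (by positivity)

theorem norm_fourierInv_toLp_two {d : ℕ} (v : 𝓢(Eu d, ℂ)) :
    ‖((𝓕⁻ v).toLp 2 : Lp ℂ 2 (volume : Measure (Eu d)))‖
      = ‖(v.toLp 2 : Lp ℂ 2 (volume : Measure (Eu d)))‖ := by
  rw [← SchwartzMap.norm_fourier_toL2_eq (𝓕⁻ v), FourierTransform.fourier_fourierInv_eq]

theorem norm_toLp_le_weightMul {d : ℕ} {ω : Eu d → ℝ} (hω : IsWeight ω) {K : ℝ} {a : Eu d → ℝ}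
    (hK : ∀ η, a η ≤ K * ω η) (f F : 𝓢(Eu d, ℂ)) (h : ∀ η, ‖f η‖ ≤ a η * ‖F η‖) :
    ‖(f.toLp 2 : Lp ℂ 2 (volume : Measure (Eu d)))‖ ≤ K * ‖weightMul hω F‖ := by
  refine Lp.norm_le_mul_norm_of_ae_le_mul ?_
  filter_upwards [f.coeFn_toLp 2, coeFn_weightMul hω F] with η h1 h2
  rw [h1, h2, norm_mul, Complex.norm_real, Real.norm_of_nonneg (hω.pos η).le, ← mul_assoc]
  exact (h η).trans (mul_le_mul_of_nonneg_right (hK η) (norm_nonneg _))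

theorem norm_iterDeriv_le_fourier {d : ℕ} {ω : Eu d → ℝ} (hω : IsWeight ω) {K : ℝ}
    (l : List (Fin d)) (hK : ∀ η : Eu d, (2 * Real.pi * ‖η‖) ^ l.length ≤ K * ω η)
    (F : 𝓢(Eu d, ℂ)) :
    ‖((iterDeriv l F).toLp 2 : Lp ℂ 2 (volume : Measure (Eu d)))‖ ≤ K * ‖weightMul hω (𝓕 F)‖ := by
  rw [← SchwartzMap.norm_fourier_toL2_eq]
  exact norm_toLp_le_weightMul hω hK _ _ (norm_fourier_iterDeriv_le l F)

theorem norm_iterDeriv_le_fourierInv {d : ℕ} {ω : Eu d → ℝ} (hω : IsWeight ω) {K : ℝ}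
    (l : List (Fin d)) (hK : ∀ η : Eu d, (2 * Real.pi * ‖η‖) ^ l.length ≤ K * ω η)
    (F : 𝓢(Eu d, ℂ)) :
    ‖((iterDeriv l F).toLp 2 : Lp ℂ 2 (volume : Measure (Eu d)))‖ ≤ K * ‖weightMul hω (𝓕⁻ F)‖ := by
  rw [← norm_fourierInv_toLp_two]
  exact norm_toLp_le_weightMul hω hK _ _ (norm_fourierInv_iterDeriv_le l F)

theorem schwartz_mul_apply {d : ℕ} (φ ψ : 𝓢(Eu d, ℂ)) (x : Eu d) :
    SchwartzMap.smulLeftCLM ℂ φ ψ x = φ x * ψ x :=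
  SchwartzMap.smulLeftCLM_apply_apply φ.hasTemperateGrowth ψ x

theorem lineDeriv_schwartz_mul {d : ℕ} (μ : Eu d) (φ ψ : 𝓢(Eu d, ℂ)) :
    (∂_{μ} (SchwartzMap.smulLeftCLM ℂ φ ψ) : 𝓢(Eu d, ℂ))
      = SchwartzMap.smulLeftCLM ℂ (∂_{μ} φ : 𝓢(Eu d, ℂ)) ψ
        + SchwartzMap.smulLeftCLM ℂ φ (∂_{μ} ψ : 𝓢(Eu d, ℂ)) := by
  ext x
  have : (SchwartzMap.smulLeftCLM ℂ φ ψ : Eu d → ℂ) = fun x => φ x * ψ x :=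
    funext (schwartz_mul_apply φ ψ)
  rw [SchwartzMap.lineDerivOp_apply_eq_fderiv, this,
    fderiv_fun_mul φ.differentiableAt ψ.differentiableAt]
  change _ = SchwartzMap.smulLeftCLM ℂ (∂_{μ} φ : 𝓢(Eu d, ℂ)) ψ x
        + SchwartzMap.smulLeftCLM ℂ φ (∂_{μ} ψ : 𝓢(Eu d, ℂ)) x
  rw [schwartz_mul_apply, schwartz_mul_apply, SchwartzMap.lineDerivOp_apply_eq_fderiv,
    SchwartzMap.lineDerivOp_apply_eq_fderiv]
  simp
  ring

/-- The scale invariant form of the Leibniz rule: if all derivatives of order `n ≤ k` of the factors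
are bounded in `L²` by `A τⁿ` and `B τⁿ`, then those of the product are bounded in `L¹` by
`(2τ)ⁿ A B`. -/
theorem integral_norm_iterDeriv_mul_le {d : ℕ} {τ : ℝ} (hτ : 0 ≤ τ) {k : ℕ} {A B : ℝ}
    (hA : 0 ≤ A) (hB : 0 ≤ B) (l : List (Fin d)) (hl : l.length ≤ k) (φ ψ : 𝓢(Eu d, ℂ))
    (hφ : ∀ l' : List (Fin d), l'.length ≤ k →
      ‖((iterDeriv l' φ).toLp 2 : Lp ℂ 2 (volume : Measure (Eu d)))‖ ≤ A * τ ^ l'.length)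
    (hψ : ∀ l' : List (Fin d), l'.length ≤ k →
      ‖((iterDeriv l' ψ).toLp 2 : Lp ℂ 2 (volume : Measure (Eu d)))‖ ≤ B * τ ^ l'.length) :
    ∫ x, ‖iterDeriv l (SchwartzMap.smulLeftCLM ℂ φ ψ) x‖ ≤ (2 * τ) ^ l.length * (A * B) := by
  induction l generalizing k A B φ ψ with
  | nil =>
    have h1 := hφ [] (by simp)
    have h2 := hψ [] (by simp)
    simp only [iterDeriv, List.foldl_nil, List.length_nil, pow_zero, mul_one, one_mul] at h1 h2 ⊢
    simp only [schwartz_mul_apply, norm_mul]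
    exact (integral_norm_mul_norm_le φ ψ).trans (mul_le_mul h1 h2 (norm_nonneg _) hA)
  | cons j l ih =>
    obtain ⟨k, rfl⟩ : ∃ k', k = k' + 1 := ⟨k - 1, by rw [List.length_cons] at hl; omega⟩
    rw [List.length_cons, Nat.add_le_add_iff_right] at hl
    rw [iterDeriv_cons, lineDeriv_schwartz_mul, iterDeriv_add]
    have h1 := ih (mul_nonneg hA hτ) hB hl (∂_{(EuclideanSpace.single j (1 : ℝ) : Eu d)} φ) ψ
      (fun l' hl' => by
        have := hφ (j :: l') (by simpa using hl')
        rw [iterDeriv_cons, List.length_cons, pow_succ] at this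
        linarith)
      (fun l' hl' => hψ l' (by omega))
    have h2 := ih hA (mul_nonneg hB hτ) hl φ (∂_{(EuclideanSpace.single j (1 : ℝ) : Eu d)} ψ)
      (fun l' hl' => hφ l' (by omega))
      (fun l' hl' => by
        have := hψ (j :: l') (by simpa using hl')
        rw [iterDeriv_cons, List.length_cons, pow_succ] at this
        linarith)
    set G₁ := iterDeriv l (SchwartzMap.smulLeftCLM ℂ
      (∂_{(EuclideanSpace.single j (1 : ℝ) : Eu d)} φ : 𝓢(Eu d, ℂ)) ψ)
    set G₂ := iterDeriv l (SchwartzMap.smulLeftCLM ℂ φ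
      (∂_{(EuclideanSpace.single j (1 : ℝ) : Eu d)} ψ : 𝓢(Eu d, ℂ)))
    calc ∫ x, ‖(G₁ + G₂) x‖ ≤ ∫ x, (‖G₁ x‖ + ‖G₂ x‖) :=
          integral_mono (G₁ + G₂).integrable.norm (G₁.integrable.norm.add G₂.integrable.norm)
            fun x => norm_add_le _ _
      _ = (∫ x, ‖G₁ x‖) + ∫ x, ‖G₂ x‖ := integral_add G₁.integrable.norm G₂.integrable.norm
      _ ≤ (2 * τ) ^ l.length * (A * τ * B) + (2 * τ) ^ l.length * (A * (B * τ)) := add_le_add h1 h2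
      _ = _ := by rw [List.length_cons, pow_succ]; ring

theorem iterate_D_apply {d : ℕ} (j : Fin d) (n : ℕ) (u : TD d) (F : 𝓢(Eu d, ℂ)) :
    ((D j)^[n] u) F = Complex.I ^ n * u (iterDeriv (List.replicate n j) F) := by
  induction n generalizing F with
  | zero => simp [iterDeriv]
  | succ n ih =>
    rw [Function.iterate_succ_apply', D_apply, ih, List.replicate_succ, iterDeriv_cons, pow_succ]
    ring

/-- The transpose of `D^β` is, up to a sign, an iterated derivative of order `|β|`. -/
theorem exists_Dpow_apply {d : ℕ} (β : Fin d → ℕ) : ∃ (l : List (Fin d)) (c : ℂ), ‖c‖ = 1 ∧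
    l.length = ∑ j, β j ∧ ∀ (u : TD d) (F : 𝓢(Eu d, ℂ)), Dpow β u F = c * u (iterDeriv l F) := by
  have key : ∀ L : List (Fin d), ∃ (l : List (Fin d)) (c : ℂ), ‖c‖ = 1 ∧
      l.length = (L.map β).sum ∧ ∀ (u : TD d) (F : 𝓢(Eu d, ℂ)),
        (L.foldr (fun j w => (D j)^[β j] w) u) F = c * u (iterDeriv l F) := by
    intro L
    induction L with
    | nil => exact ⟨[], 1, by simp, by simp, fun u F => by simp [iterDeriv]⟩
    | cons j L ih =>
      obtain ⟨l, c, hc, hl, h⟩ := ih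
      refine ⟨List.replicate (β j) j ++ l, Complex.I ^ (β j) * c, by simp [hc], by simp [hl],
        fun u F => ?_⟩
      rw [List.foldr_cons, iterate_D_apply, h, iterDeriv_append, mul_assoc]
  obtain ⟨l, c, hc, hl, h⟩ := key (List.finRange d)
  refine ⟨l, c, hc, ?_, h⟩
  rw [hl, ← List.ofFn_eq_map, List.sum_ofFn]

end Polyharmonic

namespace Polyharmonic

/-! ### Hölder continuous coefficients -/

theorem norm_le_of_holderENorm_le {d : ℕ} {θ M : ℝ≥0} {g : Eu d → ℂ} (hg : holderENorm θ g ≤ M)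
    (x : Eu d) : ‖g x‖ ≤ M := by
  have h1 : ‖g x‖ₑ ≤ M := (le_iSup (fun x => ‖g x‖ₑ) x).trans (le_self_add.trans hg)
  rw [← ofReal_norm, ENNReal.ofReal_le_coe] at h1
  exact h1

theorem holderWith_of_holderENorm_le {d : ℕ} {θ M : ℝ≥0} {g : Eu d → ℂ} (hg : holderENorm θ g ≤ M) :
    HolderWith M θ g := by
  have h2 : eHolderNorm θ g ≤ M := le_add_self.trans hg
  obtain ⟨K, hK⟩ := eHolderNorm_lt_top.1 (h2.trans_lt ENNReal.coe_lt_top)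
  have hm : MemHolder θ g := ⟨K, hK⟩
  intro x y
  refine (hm.holderWith x y).trans ?_
  gcongr
  rw [← hm.coe_nnHolderNorm_eq_eHolderNorm] at h2
  exact_mod_cast h2

theorem norm_integral_mul_le {d : ℕ} {M : ℝ} {g : Eu d → ℂ} (hg : ∀ x, ‖g x‖ ≤ M)
    (F : 𝓢(Eu d, ℂ)) : ‖∫ x, F x * g x‖ ≤ M * ∫ x, ‖F x‖ := by
  rw [← integral_const_mul]
  refine norm_integral_le_of_norm_le (F.integrable.norm.const_mul M) (Eventually.of_forall fun x => ?_)
  rw [norm_mul, mul_comm]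
  exact mul_le_mul_of_nonneg_right (hg x) (norm_nonneg _)

theorem integrable_translate_mul {d : ℕ} {M : ℝ} {g : Eu d → ℂ} (hgc : Continuous g)
    (hg : ∀ x, ‖g x‖ ≤ M) (F : 𝓢(Eu d, ℂ)) (μ : Eu d) (ε : ℝ) :
    Integrable (Function.uncurry fun (s : ℝ) (x : Eu d) => F (x + s • μ) * g x)
      ((volume.restrict (Set.uIoc 0 ε)).prod volume) := by
  have hfin : IsFiniteMeasure (volume.restrict (Set.uIoc 0 ε)) :=
    ⟨by rw [Measure.restrict_apply_univ, Set.uIoc]; exact measure_Ioc_lt_top⟩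
  have hcont : Continuous fun p : ℝ × Eu d => F (p.2 + p.1 • μ) * g p.2 := by
    have := F.continuous
    fun_prop
  have hm : AEStronglyMeasurable (Function.uncurry fun (s : ℝ) (x : Eu d) => F (x + s • μ) * g x)
      ((volume.restrict (Set.uIoc 0 ε)).prod (volume : Measure (Eu d))) :=
    hcont.aestronglyMeasurable
  have hs : ∀ s : ℝ, Integrable fun x => F (x + s • μ) := fun s =>
    F.integrable.comp_add_right (s • μ)
  have hb : ∀ (s : ℝ) (x : Eu d), ‖F (x + s • μ) * g x‖ ≤ M * ‖F (x + s • μ)‖ := fun s x => by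
    rw [norm_mul, mul_comm]
    exact mul_le_mul_of_nonneg_right (hg x) (norm_nonneg _)
  have hi : ∀ s : ℝ, Integrable fun x => F (x + s • μ) * g x := fun s =>
    ((hs s).norm.const_mul M).mono' (hcont.comp (Continuous.prodMk_right s)).aestronglyMeasurable
      (Eventually.of_forall (hb s))
  rw [integrable_prod_iff hm]
  refine ⟨Eventually.of_forall hi, ?_⟩
  refine Integrable.of_bound hm.norm.integral_prod_right' (M * ∫ x, ‖F x‖)
    (Eventually.of_forall fun s => ?_)
  rw [Real.norm_of_nonneg (by positivity), ← integral_const_mul,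
    ← integral_add_right_eq_self (fun x => M * ‖F x‖) (s • μ)]
  exact integral_mono (hi s).norm ((hs s).norm.const_mul M) (hb s)

/-- The average over `s ∈ [0, ε]` of the translates of `∂_μ F` is a difference quotient of `F`. -/
theorem integral_integral_lineDeriv {d : ℕ} {M : ℝ} {g : Eu d → ℂ} (hgc : Continuous g)
    (hg : ∀ x, ‖g x‖ ≤ M) (F : 𝓢(Eu d, ℂ)) (μ : Eu d) (ε : ℝ) :
    ∫ s in (0)..ε, ∫ x, (∂_{μ} F : 𝓢(Eu d, ℂ)) (x + s • μ) * g x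
      = ∫ x, (F (x + ε • μ) - F x) * g x := by
  set F' : 𝓢(Eu d, ℂ) := ∂_{μ} F with hF'
  have hint := integrable_translate_mul hgc hg F' μ ε
  rw [intervalIntegral_integral_swap hint]
  congr 1 with x
  rw [intervalIntegral.integral_mul_const]
  congr 1
  have hd : ∀ s : ℝ, HasDerivAt (fun s : ℝ => F (x + s • μ)) (F' (x + s • μ)) s := fun s => by
    have h1 : HasDerivAt (fun s : ℝ => x + s • μ) μ s := by
      simpa using ((hasDerivAt_id s).smul_const μ).const_add x
    rw [hF', SchwartzMap.lineDerivOp_apply_eq_fderiv]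
    exact (F.hasFDerivAt _).comp_hasDerivAt s h1
  rw [intervalIntegral.integral_eq_sub_of_hasDerivAt (fun s _ => hd s)]
  · simp
  · refine Continuous.intervalIntegrable ?_ _ _
    have := F'.continuous
    fun_prop

/-- Let `J s` be the integral of `g` against the translate of `∂_μ F` by `s`. Hölder continuity of
`g` bounds `J s - J 0` by `ε^θ ‖∂_μ F‖` for `s ≤ ε`, while the average of `J` over `[0, ε]` is a
difference quotient of `F`, of size `ε⁻¹ ‖F‖`. At the scale `h`, where a derivative costs `h⁻¹`, both are small
compared to the trivial bound for `J 0` if `ε = √h`. -/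
theorem norm_integral_lineDeriv_mul_le {d : ℕ} {θ M : ℝ≥0} (hθ : 0 < θ) {g : Eu d → ℂ}
    (hg : holderENorm θ g ≤ M) (F : 𝓢(Eu d, ℂ)) (μ : Eu d) (hμ : ‖μ‖ = 1) {ε : ℝ} (hε : 0 < ε) :
    ‖∫ x, (∂_{μ} F : 𝓢(Eu d, ℂ)) x * g x‖
      ≤ M * ε ^ (θ : ℝ) * (∫ x, ‖(∂_{μ} F : 𝓢(Eu d, ℂ)) x‖) + 2 * M * ε⁻¹ * ∫ x, ‖F x‖ := by
  have hb := norm_le_of_holderENorm_le hg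
  have hH := holderWith_of_holderENorm_le hg
  have hgc : Continuous g := hH.continuous hθ
  set F' : 𝓢(Eu d, ℂ) := ∂_{μ} F with hF'
  set J : ℝ → ℂ := fun s => ∫ x, F' (x + s • μ) * g x with hJ
  have hbi : ∀ G : Eu d → ℂ, Integrable G → Integrable fun x => G x * g x := fun G hG =>
    hG.mul_bdd (c := M) hgc.aestronglyMeasurable (Eventually.of_forall hb)
  have hJ0 : J 0 = ∫ x, F' x * g x := by simp [hJ]
  have hJs : ∀ s ∈ Set.Icc (0 : ℝ) ε, ‖J s - J 0‖ ≤ M * ε ^ (θ : ℝ) * ∫ x, ‖F' x‖ := by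
    intro s hs
    have h1 : J s = ∫ x, F' x * g (x - s • μ) := by
      rw [hJ, ← integral_add_right_eq_self (fun x => F' x * g (x - s • μ)) (s • μ)]
      simp
    have hi2 : Integrable fun x => F' x * g (x - s • μ) :=
      F'.integrable.mul_bdd (c := M) (by fun_prop) (Eventually.of_forall fun x => hb _)
    rw [h1, hJ0, ← integral_sub hi2 (hbi _ F'.integrable), ← integral_const_mul]
    refine norm_integral_le_of_norm_le (F'.integrable.norm.const_mul _)
      (Eventually.of_forall fun x => ?_)
    rw [← mul_sub, norm_mul, mul_comm]
    refine mul_le_mul_of_nonneg_right ?_ (norm_nonneg _)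
    rw [← dist_eq_norm]
    refine (hH.dist_le _ _).trans ?_
    refine mul_le_mul_of_nonneg_left (Real.rpow_le_rpow dist_nonneg ?_ θ.2) M.2
    rw [dist_eq_norm, sub_sub_cancel_left, norm_neg, norm_smul, hμ, mul_one,
      Real.norm_of_nonneg hs.1]
    exact hs.2
  have hJi : IntervalIntegrable J volume 0 ε := by
    rw [intervalIntegrable_iff]
    exact (integrable_translate_mul hgc hb F' μ ε).integral_prod_left
  have hsub : (ε : ℂ) * J 0 = (∫ s in (0)..ε, J s) - ∫ s in (0)..ε, (J s - J 0) := by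
    rw [intervalIntegral.integral_sub hJi (by simp)]
    simp
  have h1 : ‖∫ s in (0)..ε, (J s - J 0)‖ ≤ M * ε ^ (θ : ℝ) * (∫ x, ‖F' x‖) * ε := by
    have := intervalIntegral.norm_integral_le_of_norm_le_const (a := 0) (b := ε)
      (f := fun s => J s - J 0) (C := M * ε ^ (θ : ℝ) * ∫ x, ‖F' x‖) (fun s hs => by
        rw [Set.uIoc_of_le hε.le] at hs
        exact hJs s ⟨hs.1.le, hs.2⟩)
    simpa [abs_of_pos hε] using this
  have h2 : ‖∫ s in (0)..ε, J s‖ ≤ 2 * M * ∫ x, ‖F x‖ := by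
    rw [hJ, integral_integral_lineDeriv hgc hb F μ ε]
    simp only [sub_mul]
    rw [integral_sub (hbi _ (F.integrable.comp_add_right _)) (hbi _ F.integrable)]
    refine (norm_sub_le _ _).trans ?_
    have ha := norm_integral_mul_le hb F
    have hc : ‖∫ x, F (x + ε • μ) * g x‖ ≤ M * ∫ x, ‖F x‖ := by
      rw [← integral_add_right_eq_self (fun x => ‖F x‖) (ε • μ), ← integral_const_mul]
      refine norm_integral_le_of_norm_le ((F.integrable.comp_add_right (ε • μ)).norm.const_mul M)
        (Eventually.of_forall fun x => ?_)
      rw [norm_mul, mul_comm]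
      exact mul_le_mul_of_nonneg_right (hb x) (norm_nonneg _)
    linarith
  rw [← hJ0]
  have h3 : ε * ‖J 0‖ ≤ 2 * M * (∫ x, ‖F x‖) + M * ε ^ (θ : ℝ) * (∫ x, ‖F' x‖) * ε := by
    calc ε * ‖J 0‖ = ‖(ε : ℂ) * J 0‖ := by
          rw [norm_mul, Complex.norm_real, Real.norm_of_nonneg hε.le]
      _ ≤ _ := by rw [hsub]; exact (norm_sub_le _ _).trans (add_le_add h2 h1)
  rw [← mul_le_mul_iff_right₀ hε]
  refine h3.trans (le_of_eq ?_)
  field_simp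
  ring

theorem memLp_top_of_holderENorm_le {d : ℕ} {θ M : ℝ≥0} (hθ : 0 < θ) {g : Eu d → ℂ}
    (hg : holderENorm θ g ≤ M) : MemLp g ∞ volume :=
  memLp_top_of_holderENorm hθ (hg.trans_lt ENNReal.coe_lt_top)

/-- The bound by the supremum norm of the coefficient: all derivatives are moved to the product. -/
theorem norm_Dpow_ofBounded_mul_le {d : ℕ} {θ M : ℝ≥0} (hθ : 0 < θ) {g : Eu d → ℂ}
    (hg : holderENorm θ g ≤ M) {τ : ℝ} (hτ : 0 ≤ τ) {k : ℕ} {A B : ℝ}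
    (hA : 0 ≤ A) (hB : 0 ≤ B) (β : Fin d → ℕ) (hβ : ∑ j, β j ≤ k) (φ ψ : 𝓢(Eu d, ℂ))
    (hφ : ∀ l' : List (Fin d), l'.length ≤ k →
      ‖((iterDeriv l' φ).toLp 2 : Lp ℂ 2 (volume : Measure (Eu d)))‖ ≤ A * τ ^ l'.length)
    (hψ : ∀ l' : List (Fin d), l'.length ≤ k →
      ‖((iterDeriv l' ψ).toLp 2 : Lp ℂ 2 (volume : Measure (Eu d)))‖ ≤ B * τ ^ l'.length) :
    ‖Dpow β (ofBounded g) (SchwartzMap.smulLeftCLM ℂ φ ψ)‖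
      ≤ M * ((2 * τ) ^ (∑ j, β j) * (A * B)) := by
  obtain ⟨l, c, hc, hl, h⟩ := exists_Dpow_apply β
  rw [h, norm_mul, hc, one_mul, ofBounded_apply (memLp_top_of_holderENorm_le hθ hg)]
  refine (norm_integral_mul_le (norm_le_of_holderENorm_le hg) _).trans ?_
  rw [← hl] at hβ ⊢
  exact mul_le_mul_of_nonneg_left (integral_norm_iterDeriv_mul_le hτ hA hB l hβ φ ψ hφ hψ) M.2

/-- At the scale `h`, the Hölder continuity of the coefficient gains the factor `h^{θ/2}` over the
bound by the supremum norm. -/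
theorem norm_Dpow_ofBounded_mul_le_gain {d : ℕ} {θ M : ℝ≥0} (hθ : 0 < θ) (hθ1 : θ ≤ 1)
    {g : Eu d → ℂ} (hg : holderENorm θ g ≤ M) {h : ℝ} (hh : 0 < h) (hh1 : h ≤ 1) {k : ℕ}
    (hk : 1 ≤ k) {A B : ℝ} (hA : 0 ≤ A) (hB : 0 ≤ B) (β : Fin d → ℕ) (hβ : ∑ j, β j ≤ k)
    (φ ψ : 𝓢(Eu d, ℂ))
    (hφ : ∀ l' : List (Fin d), l'.length ≤ k →
      ‖((iterDeriv l' φ).toLp 2 : Lp ℂ 2 (volume : Measure (Eu d)))‖ ≤ A * h⁻¹ ^ l'.length)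
    (hψ : ∀ l' : List (Fin d), l'.length ≤ k →
      ‖((iterDeriv l' ψ).toLp 2 : Lp ℂ 2 (volume : Measure (Eu d)))‖ ≤ B * h⁻¹ ^ l'.length) :
    ‖Dpow β (ofBounded g) (SchwartzMap.smulLeftCLM ℂ φ ψ)‖
      ≤ 2 * M * √h ^ (θ : ℝ) * ((2 * h⁻¹) ^ k * (A * B)) := by
  have hτ : 1 ≤ h⁻¹ := (one_le_inv₀ hh).2 hh1
  have hτ0 : 0 ≤ h⁻¹ := by positivity
  have hs : 0 < √h := Real.sqrt_pos.2 hh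
  have hs1 : √h ≤ 1 := Real.sqrt_le_one.2 hh1
  have hρ : √h ≤ √h ^ (θ : ℝ) := by
    conv_lhs => rw [← Real.rpow_one √h]
    exact Real.rpow_le_rpow_of_exponent_ge hs hs1 (by exact_mod_cast hθ1)
  have hM : (0 : ℝ) ≤ M := M.2
  have hAB : 0 ≤ A * B := mul_nonneg hA hB
  have hsh : √h * √h = h := Real.mul_self_sqrt hh.le
  rcases hn : ∑ j, β j with _ | n
  · have h0 := norm_Dpow_ofBounded_mul_le hθ hg hτ0 hA hB β hβ φ ψ hφ hψ
    rw [hn, pow_zero, one_mul] at h0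
    refine h0.trans ?_
    -- the loss of `h^{-k}` exceeds the gain, as `k ≥ 1`
    have h1 : 2 * h⁻¹ ≤ (2 * h⁻¹) ^ k := le_self_pow₀ (by linarith) (by omega)
    have h2 : h ≤ √h ^ (θ : ℝ) := by nlinarith
    have h3 : (1 : ℝ) ≤ √h ^ (θ : ℝ) * (2 * h⁻¹) ^ k := by
      calc (1 : ℝ) ≤ h * (2 * h⁻¹) := by field_simp; norm_num
        _ ≤ _ := mul_le_mul h2 h1 (by positivity) (by positivity)
    have h4 : M * (A * B) * 1 ≤ M * (A * B) * (√h ^ (θ : ℝ) * (2 * h⁻¹) ^ k) :=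
      mul_le_mul_of_nonneg_left h3 (by positivity)
    have h5 : 0 ≤ M * (A * B) * (√h ^ (θ : ℝ) * (2 * h⁻¹) ^ k) := by positivity
    linarith
  · -- one of the derivatives is used for the gain
    obtain ⟨l, c, hc, hl, hD⟩ := exists_Dpow_apply β
    rw [hD, norm_mul, hc, one_mul, ofBounded_apply (memLp_top_of_holderENorm_le hθ hg)]
    rw [hn] at hl hβ
    obtain ⟨l', j, rfl⟩ : ∃ l' j, l = l' ++ [j] :=
      ⟨l.dropLast, l.getLast (by rintro rfl; simp at hl),
        (List.dropLast_append_getLast _).symm⟩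
    have hl' : l'.length = n := by simpa using hl
    have hμ : ‖(EuclideanSpace.single j (1 : ℝ) : Eu d)‖ = 1 := by simp
    have hF : iterDeriv (l' ++ [j]) (SchwartzMap.smulLeftCLM ℂ φ ψ) =
        ∂_{(EuclideanSpace.single j (1 : ℝ) : Eu d)}
          (iterDeriv l' (SchwartzMap.smulLeftCLM ℂ φ ψ)) := iterDeriv_append _ _ _
    have h1 := integral_norm_iterDeriv_mul_le hτ0 hA hB (l' ++ [j]) (by omega) φ ψ hφ hψ
    have h2 := integral_norm_iterDeriv_mul_le hτ0 hA hB l' (by omega) φ ψ hφ hψ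
    rw [hl] at h1
    rw [hl'] at h2
    rw [hF] at h1 ⊢
    refine (norm_integral_lineDeriv_mul_le hθ hg _ _ hμ hs).trans ?_
    have hpow : (2 * h⁻¹) ^ (n + 1) ≤ (2 * h⁻¹) ^ k := pow_le_pow_right₀ (by linarith) hβ
    have hhalf : (√h)⁻¹ = √h * h⁻¹ := by
      field_simp
      rw [sq]
      exact hsh.symm
    calc _ ≤ M * √h ^ (θ : ℝ) * ((2 * h⁻¹) ^ (n + 1) * (A * B))
          + 2 * M * (√h)⁻¹ * ((2 * h⁻¹) ^ n * (A * B)) := by gcongr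
      _ = M * (√h ^ (θ : ℝ) + √h) * ((2 * h⁻¹) ^ (n + 1) * (A * B)) := by
          rw [hhalf, pow_succ]; ring
      _ ≤ M * (√h ^ (θ : ℝ) + √h ^ (θ : ℝ)) * ((2 * h⁻¹) ^ k * (A * B)) := by gcongr
      _ = _ := by ring

end Polyharmonic

namespace Polyharmonic

/-! ### Products with Sobolev functions -/

/-- The map `φ ↦ ω 𝓕φ` from Schwartz functions to `L²`. -/
noncomputable def weightFourier {d : ℕ} {ω : Eu d → ℝ} (hω : IsWeight ω) :
    𝓢(Eu d, ℂ) →ₗ[ℂ] Lp ℂ 2 (volume : Measure (Eu d)) :=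
  weightMul hω ∘ₗ fourierₗ ℂ 𝓢(Eu d, ℂ)

/-- The map `φ ↦ ω 𝓕⁻φ` from Schwartz functions to `L²`. -/
noncomputable def weightFourierInv {d : ℕ} {ω : Eu d → ℝ} (hω : IsWeight ω) :
    𝓢(Eu d, ℂ) →ₗ[ℂ] Lp ℂ 2 (volume : Measure (Eu d)) :=
  weightMul hω ∘ₗ fourierInvₗ ℂ 𝓢(Eu d, ℂ)

theorem weightFourier_apply {d : ℕ} {ω : Eu d → ℝ} (hω : IsWeight ω) (φ : 𝓢(Eu d, ℂ)) :
    weightFourier hω φ = weightMul hω (𝓕 φ) := rfl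

theorem weightFourierInv_apply {d : ℕ} {ω : Eu d → ℝ} (hω : IsWeight ω) (φ : 𝓢(Eu d, ℂ)) :
    weightFourierInv hω φ = weightMul hω (𝓕⁻ φ) := rfl

theorem denseRange_weightFourier {d : ℕ} {ω : Eu d → ℝ} (hω : IsWeight ω) :
    DenseRange (weightFourier hω) := by
  have h : Function.Surjective (fun φ : 𝓢(Eu d, ℂ) => 𝓕 φ) := fun φ =>
    ⟨𝓕⁻ φ, FourierTransform.fourier_fourierInv_eq φ⟩
  change Dense (Set.range (weightMul hω ∘ fun φ : 𝓢(Eu d, ℂ) => 𝓕 φ))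
  rw [h.range_comp]
  exact denseRange_weightMul hω

theorem exists_tendsto_weightFourier {d : ℕ} {ω : Eu d → ℝ} (hω : IsWeight ω)
    (G : Lp ℂ 2 (volume : Measure (Eu d))) :
    ∃ φ : ℕ → 𝓢(Eu d, ℂ), Tendsto (fun n => weightFourier hω (φ n)) atTop (𝓝 G) := by
  obtain ⟨x, hx, hlim⟩ := mem_closure_iff_seq_limit.1 (denseRange_weightFourier hω G)
  choose φ hφ using hx
  exact ⟨φ, by simpa only [hφ] using hlim⟩

theorem continuous_weightMul_besselWeight {d : ℕ} (k : ℕ) :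
    Continuous (weightMul (isWeight_besselWeight (d := d) k)) := by
  have hN : (fun x : Eu d => (((1 + ‖x‖ ^ 2) ^ ((k : ℝ) / 2) : ℝ) : ℂ)).HasTemperateGrowth := by
    fun_prop
  have h : ⇑(weightMul (isWeight_besselWeight (d := d) k)) = fun φ =>
      SchwartzMap.toLpCLM ℂ ℂ 2 volume (SchwartzMap.smulLeftCLM ℂ
        (fun x : Eu d => (((1 + ‖x‖ ^ 2) ^ ((k : ℝ) / 2) : ℝ) : ℂ)) φ) := by
    ext1 φ
    refine Lp.ext ?_
    filter_upwards [coeFn_weightMul (isWeight_besselWeight (d := d) k) φ,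
      (SchwartzMap.smulLeftCLM ℂ (fun x : Eu d => (((1 + ‖x‖ ^ 2) ^ ((k : ℝ) / 2) : ℝ) : ℂ)) φ).coeFn_toLp
        2 volume] with η h1 h2
    rw [h1, SchwartzMap.toLpCLM_apply, h2, SchwartzMap.smulLeftCLM_apply_apply hN]
    rfl
  rw [h]
  fun_prop

/-- The pointwise product of Schwartz functions as a bilinear map. -/
noncomputable def schwartzMul {d : ℕ} : 𝓢(Eu d, ℂ) →ₗ[ℂ] 𝓢(Eu d, ℂ) →ₗ[ℂ] 𝓢(Eu d, ℂ) :=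
  LinearMap.mk₂ ℂ (fun φ ψ => SchwartzMap.smulLeftCLM ℂ φ ψ)
    (fun φ φ' ψ => by
      ext x
      change _ = SchwartzMap.smulLeftCLM ℂ φ ψ x + SchwartzMap.smulLeftCLM ℂ φ' ψ x
      simp only [schwartz_mul_apply]
      exact add_mul _ _ _)
    (fun c φ ψ => by
      ext x
      change _ = c • SchwartzMap.smulLeftCLM ℂ φ ψ x
      simp only [schwartz_mul_apply, smul_eq_mul]
      exact mul_assoc _ _ _)
    (fun φ ψ ψ' => map_add _ _ _) (fun c φ ψ => map_smul _ _ _)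

theorem schwartzMul_apply {d : ℕ} (φ ψ : 𝓢(Eu d, ℂ)) :
    schwartzMul φ ψ = SchwartzMap.smulLeftCLM ℂ φ ψ := rfl

theorem HasHat.sobolevENorm_sub_eq {d k : ℕ} {u : TD d} {g : Eu d → ℂ} (hu : HasHat u g)
    (hg : MemLp (fun η => (besselWeight k η : ℂ) * g η) 2 volume) (φ : 𝓢(Eu d, ℂ)) :
    sobolevENorm k ((φ : TD d) - u)
      = ‖weightFourier (isWeight_besselWeight k) φ - hg.toLp _‖ₑ := by
  have h1 := (isWeight_besselWeight k).memLp (𝓕 φ)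
  have h2 : (fun η => (besselWeight k η : ℂ) * (𝓕 φ η - g η))
      = (fun η => (besselWeight k η : ℂ) * 𝓕 φ η) - fun η => (besselWeight k η : ℂ) * g η := by
    ext η
    simp [mul_sub]
  rw [((hasHat_schwartz φ).sub hu).sobolevENorm_eq (by rw [h2]; exact h1.sub hg), h2,
    ← Lp.enorm_toLp (h1.sub hg), MemLp.toLp_sub h1 hg]
  rfl

/-- The product of a tempered distribution `q` with `u ∈ W^{k,2}` exists if
`(φ, ψ) ↦ q (φ ψ)` is bounded in the norm of `W^{k,2}`. -/
theorem exists_isProduct {d k : ℕ} {q u : TD d} {g : Eu d → ℂ} (hu : HasHat u g)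
    (hg : MemLp (fun η => (besselWeight k η : ℂ) * g η) 2 volume) {C : ℝ}
    (hq : ∀ φ ψ : 𝓢(Eu d, ℂ), ‖q (SchwartzMap.smulLeftCLM ℂ φ ψ)‖ ≤
      C * (‖weightFourier (isWeight_besselWeight k) φ‖ *
        ‖weightFourierInv (isWeight_besselWeight k) ψ‖)) :
    ∃ p, IsProduct k q u p := by
  set e := weightFourier (isWeight_besselWeight (d := d) k) with he
  set e' := weightFourierInv (isWeight_besselWeight (d := d) k) with he'
  have hed : DenseRange e := denseRange_weightFourier _
  set G : Lp ℂ 2 (volume : Measure (Eu d)) := hg.toLp _ with hG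
  let A : 𝓢(Eu d, ℂ) →ₗ[ℂ] 𝓢(Eu d, ℂ) →ₗ[ℂ] ℂ := schwartzMul.flip.compr₂ q.toLinearMap
  have hA : ∀ ψ φ, A ψ φ = q (SchwartzMap.smulLeftCLM ℂ φ ψ) := fun ψ φ => rfl
  have hb : ∀ ψ φ, ‖A ψ φ‖ ≤ C * ‖e' ψ‖ * ‖e φ‖ := fun ψ φ => by
    rw [hA]
    exact (hq φ ψ).trans (le_of_eq (by ring))
  have hext : ∀ ψ φ, (A ψ).extendOfNorm e (e φ) = A ψ φ := fun ψ φ =>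
    LinearMap.extendOfNorm_eq hed ⟨_, hb ψ⟩ φ
  -- for fixed `ψ`, the functional `φ ↦ q (φ ψ)` extends by continuity to `u`
  let r : 𝓢(Eu d, ℂ) →ₗ[ℂ] ℂ :=
    { toFun := fun ψ => (A ψ).extendOfNorm e G
      map_add' := fun ψ ψ' => by
        rw [LinearMap.extendOfNorm_unique hed _ (hb (ψ + ψ'))
          ((A ψ).extendOfNorm e + (A ψ').extendOfNorm e) (by ext φ; simp [hext])]
        rfl
      map_smul' := fun c ψ => by
        rw [LinearMap.extendOfNorm_unique hed _ (hb (c • ψ))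
          (c • (A ψ).extendOfNorm e) (by ext φ; simp [hext])]
        rfl }
  have hr : ∀ ψ, r ψ = (A ψ).extendOfNorm e G := fun ψ => rfl
  have hrc : Continuous r := by
    refine continuous_of_continuousAt_zero r ?_
    have hlim : Tendsto (fun ψ => C * ‖e' ψ‖ * ‖G‖) (𝓝 0) (𝓝 0) := by
      have hc : Continuous fun ψ => C * ‖e' ψ‖ * ‖G‖ := by
        have : Continuous e' := (continuous_weightMul_besselWeight k).comp
          (fourierInvCLM ℂ 𝓢(Eu d, ℂ)).continuous
        fun_prop
      simpa using hc.tendsto 0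
    rw [ContinuousAt, map_zero]
    refine squeeze_zero_norm (fun ψ => ?_) hlim
    rw [hr]
    exact LinearMap.norm_extendOfNorm_apply_le hed _ (hb ψ) G
  let p : TD d := ContinuousLinearMap.toPointwiseConvergenceCLM _ _ _ _ ⟨r, hrc⟩
  have hp : ∀ ψ, p ψ = (A ψ).extendOfNorm e G := fun ψ => rfl
  have hiff : ∀ φ : ℕ → 𝓢(Eu d, ℂ),
      Tendsto (fun n => sobolevENorm k ((φ n : TD d) - u)) atTop (𝓝 0) ↔
        Tendsto (fun n => e (φ n)) atTop (𝓝 G) := fun φ => by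
    rw [tendsto_iff_edist_tendsto_0]
    simp only [hu.sobolevENorm_sub_eq hg, edist_eq_enorm_sub]
    rfl
  refine ⟨p, fun φ hφ => ?_, ?_⟩
  · rw [PointwiseConvergenceCLM.tendsto_iff_forall_tendsto]
    intro ψ
    rw [hp]
    refine Tendsto.congr (fun n => ?_)
      ((((A ψ).extendOfNorm e).continuous.tendsto G).comp ((hiff φ).1 hφ))
    simp only [Function.comp_apply, hext, hA]
    rfl
  · obtain ⟨φ, hφ⟩ := exists_tendsto_weightFourier (isWeight_besselWeight k) G
    exact ⟨φ, (hiff φ).2 hφ⟩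

end Polyharmonic

namespace Polyharmonic

/-! ### The symbol -/

/-- The symbol `P_ζ(hξ)` at `ξ = 2πη`, in Mathlib's normalization of the frequency. -/
noncomputable def scaledSymbol {d : ℕ} (ζ : Fin d → ℂ) (h : ℝ) (η : Eu d) : ℂ :=
  symbolP ζ (h • ((2 * Real.pi) • η))

/-- The weight `(h + |P_ζ(hξ)|)^{m/2}` of the norm of `X^{m/2}` at `ξ = 2πη`. -/
noncomputable def xWeight {d : ℕ} (ζ : Fin d → ℂ) (h : ℝ) (m : ℕ) (η : Eu d) : ℝ :=
  √(h + ‖scaledSymbol ζ h η‖) ^ m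

theorem continuous_symbolP {d : ℕ} (ζ : Fin d → ℂ) : Continuous (symbolP (d := d) ζ) := by
  unfold symbolP
  fun_prop

theorem continuous_scaledSymbol {d : ℕ} (ζ : Fin d → ℂ) (h : ℝ) :
    Continuous (scaledSymbol (d := d) ζ h) :=
  (continuous_symbolP ζ).comp (by fun_prop)

/-- The real and imaginary parts of the symbol. -/
theorem symbolP_eq {d : ℕ} {ζ : Fin d → ℂ} {μ₁ μ₂ : Eu d}
    (hζ : ∀ j, ζ j = (μ₁ j : ℂ) + Complex.I * (μ₂ j : ℂ)) (x : Eu d) :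
    symbolP ζ x = ((‖x‖ ^ 2 + 2 * inner ℝ μ₂ x : ℝ) : ℂ) + ((-2 * inner ℝ μ₁ x : ℝ) : ℂ) * Complex.I := by
  have h : ∀ μ : Eu d, ((inner ℝ μ x : ℝ) : ℂ) = ∑ j, (μ j : ℂ) * (x j : ℂ) := fun μ => by
    rw [PiLp.inner_apply]
    push_cast
    congr 1 with j
    simp [mul_comm]
  have hs : ∑ j, ζ j * (x j : ℂ) = (inner ℝ μ₁ x : ℝ) + Complex.I * (inner ℝ μ₂ x : ℝ) := by
    rw [h, h, Finset.mul_sum, ← Finset.sum_add_distrib]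
    congr 1 with j
    rw [hζ]
    ring
  rw [symbolP, hs]
  push_cast
  linear_combination (-2 * (inner ℝ μ₂ x : ℂ)) * Complex.I_sq

theorem norm_symbolP_le {d : ℕ} {ζ : Fin d → ℂ} (hζ : ζ ∈ zetaSet d) (x : Eu d) :
    ‖symbolP ζ x‖ ≤ ‖x‖ ^ 2 + 4 * ‖x‖ := by
  obtain ⟨μ₁, μ₂, h1, h2, -, hζ⟩ := hζ
  rw [symbolP_eq hζ]
  have i1 := abs_real_inner_le_norm μ₁ x
  have i2 := abs_real_inner_le_norm μ₂ x
  rw [h1, one_mul] at i1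
  rw [h2, one_mul] at i2
  refine (norm_add_le _ _).trans ?_
  rw [norm_mul, Complex.norm_I, mul_one, Complex.norm_real, Complex.norm_real, Real.norm_eq_abs,
    Real.norm_eq_abs, abs_mul]
  have h3 : |‖x‖ ^ 2 + 2 * inner ℝ μ₂ x| ≤ ‖x‖ ^ 2 + 2 * ‖x‖ := by
    refine (abs_add_le _ _).trans ?_
    rw [abs_of_nonneg (by positivity : 0 ≤ ‖x‖ ^ 2), abs_mul]
    norm_num
    linarith
  norm_num
  linarith

/-- The symbol is elliptic at infinity: its real part is at least `‖x‖² - 2 ‖x‖`. -/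
theorem sq_norm_le_symbolP {d : ℕ} {ζ : Fin d → ℂ} (hζ : ζ ∈ zetaSet d) (x : Eu d) :
    ‖x‖ ^ 2 ≤ 64 * (1 + ‖symbolP ζ x‖) := by
  obtain ⟨μ₁, μ₂, h1, h2, -, hζ⟩ := hζ
  have i2 := abs_real_inner_le_norm μ₂ x
  rw [h2, one_mul] at i2
  have h3 : ‖x‖ ^ 2 + 2 * inner ℝ μ₂ x ≤ ‖symbolP ζ x‖ := by
    refine le_trans (le_of_eq ?_) ((le_abs_self _).trans (Complex.abs_re_le_norm (symbolP ζ x)))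
    rw [symbolP_eq hζ]
    simp [-Complex.ofReal_pow]
  have h4 := (abs_le.1 i2).1
  have h5 := norm_nonneg (symbolP ζ x)
  have h6 := norm_nonneg x
  rcases le_or_gt ‖x‖ 8 with hx | hx <;> nlinarith

theorem abs_inner_le_symbolP {d : ℕ} {ζ : Fin d → ℂ} {μ₁ μ₂ : Eu d}
    (hζ : ∀ j, ζ j = (μ₁ j : ℂ) + Complex.I * (μ₂ j : ℂ)) (x : Eu d) :
    2 * |inner ℝ μ₁ x| ≤ ‖symbolP ζ x‖ := by
  refine le_trans (le_of_eq ?_) (Complex.abs_im_le_norm (symbolP ζ x))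
  rw [symbolP_eq hζ]
  simp only [Complex.add_im, Complex.mul_im, Complex.ofReal_re, Complex.ofReal_im, Complex.I_re,
    Complex.I_im]
  simp [abs_mul]

theorem norm_apply_le_of_mem_zetaSet {d : ℕ} {ζ : Fin d → ℂ} (hζ : ζ ∈ zetaSet d) (j : Fin d) :
    ‖ζ j‖ ≤ 2 := by
  obtain ⟨μ₁, μ₂, h1, h2, -, hζ⟩ := hζ
  rw [hζ]
  refine (norm_add_le _ _).trans ?_
  have i1 := abs_apply_le_norm μ₁ j
  have i2 := abs_apply_le_norm μ₂ j
  rw [norm_mul, Complex.norm_I, one_mul, Complex.norm_real, Complex.norm_real, Real.norm_eq_abs,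
    Real.norm_eq_abs]
  linarith

theorem besselWeight_eq {d : ℕ} (k : ℕ) (η : Eu d) : besselWeight k η = √(1 + ‖η‖ ^ 2) ^ k := by
  rw [besselWeight, Real.sqrt_eq_rpow, ← Real.rpow_mul_natCast (by positivity)]
  congr 1
  ring

theorem norm_scale {d : ℕ} {h : ℝ} (hh : 0 < h) (η : Eu d) :
    ‖h • ((2 * Real.pi) • η)‖ = h * (2 * Real.pi * ‖η‖) := by
  rw [norm_smul, norm_smul, Real.norm_of_nonneg hh.le, Real.norm_of_nonneg (by positivity)]

theorem isWeight_xWeight {d : ℕ} {ζ : Fin d → ℂ} (hζ : ζ ∈ zetaSet d) {h : ℝ} (hh : 0 < h) (m : ℕ) :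
    IsWeight (xWeight ζ h m) := by
  refine ⟨?_, ⟨√h ^ m, by positivity, fun η => ?_⟩, ?_⟩
  · have := continuous_scaledSymbol ζ h
    unfold xWeight
    fun_prop
  · unfold xWeight
    gcongr
    linarith [norm_nonneg (scaledSymbol ζ h η)]
  · set c := h * (2 * Real.pi) with hc
    have hc0 : 0 < c := by positivity
    refine ⟨√(h + c ^ 2 + 4 * c) ^ m, m, fun η => ?_⟩
    rw [besselWeight_eq, ← mul_pow, ← Real.sqrt_mul (by positivity), xWeight]
    gcongr
    have := norm_symbolP_le hζ (h • ((2 * Real.pi) • η))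
    rw [norm_scale hh, ← mul_assoc, ← hc] at this
    rw [scaledSymbol]
    have hη := norm_nonneg η
    have h1 : ‖η‖ ≤ 1 + ‖η‖ ^ 2 := by nlinarith
    have h2 : c * ‖η‖ ≤ c * (1 + ‖η‖ ^ 2) := mul_le_mul_of_nonneg_left h1 hc0.le
    nlinarith [sq_nonneg c, sq_nonneg ‖η‖, mul_nonneg hh.le (sq_nonneg ‖η‖)]

/-- Up to the order `m`, every derivative costs a factor `h⁻¹` in the norm of `X^{m/2}`. -/
theorem pow_le_xWeight {d : ℕ} {ζ : Fin d → ℂ} (hζ : ζ ∈ zetaSet d) {h : ℝ} (hh : 0 < h)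
    (hh1 : h ≤ 1) {n m : ℕ} (hn : n ≤ m) (η : Eu d) :
    (2 * Real.pi * ‖η‖) ^ n ≤ 8 ^ m * (√h ^ m)⁻¹ * h⁻¹ ^ n * xWeight ζ h m η := by
  set P := ‖scaledSymbol ζ h η‖ with hP
  have hP0 : 0 ≤ P := norm_nonneg _
  have hs : 0 < √h := Real.sqrt_pos.2 hh
  set b := √(h + P) / √h with hb
  have hb1 : 1 ≤ b := by
    rw [hb, one_le_div hs]
    exact Real.sqrt_le_sqrt (by linarith)
  have hb2 : b ^ 2 = (h + P) / h := by
    rw [hb, div_pow, Real.sq_sqrt (by positivity), Real.sq_sqrt hh.le]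
  have hx : h * (2 * Real.pi * ‖η‖) ≤ 8 * b := by
    refine abs_le_of_sq_le_sq' ?_ (by positivity) |>.2
    have h1 := sq_norm_le_symbolP hζ (h • ((2 * Real.pi) • η))
    rw [norm_scale hh] at h1
    refine h1.trans ?_
    rw [mul_pow, hb2]
    have h2 : 1 + P ≤ (h + P) / h := by
      rw [le_div_iff₀ hh]
      nlinarith
    change 64 * (1 + P) ≤ _
    linarith
  have h3 : (h * (2 * Real.pi * ‖η‖)) ^ n ≤ (8 * b) ^ m :=
    (pow_le_pow_left₀ (by positivity) hx n).trans (pow_le_pow_right₀ (by linarith) hn)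
  have h4 : (8 * b) ^ m = 8 ^ m * (√h ^ m)⁻¹ * xWeight ζ h m η := by
    rw [xWeight, ← hP, hb, mul_pow, div_pow]
    field_simp
  calc (2 * Real.pi * ‖η‖) ^ n = h⁻¹ ^ n * (h * (2 * Real.pi * ‖η‖)) ^ n := by
        rw [← mul_pow]
        field_simp
    _ ≤ h⁻¹ ^ n * (8 ^ m * (√h ^ m)⁻¹ * xWeight ζ h m η) := by
        rw [← h4]
        gcongr
    _ = _ := by ring

theorem pow_le_besselWeight {d : ℕ} {n k : ℕ} (hn : n ≤ k) (η : Eu d) :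
    (2 * Real.pi * ‖η‖) ^ n ≤ (2 * Real.pi) ^ k * 1 ^ n * besselWeight k η := by
  rw [besselWeight_eq, one_pow, mul_one, ← mul_pow]
  have h1 : 1 ≤ √(1 + ‖η‖ ^ 2) := Real.one_le_sqrt.2 (by nlinarith [sq_nonneg ‖η‖])
  have h2 : ‖η‖ ≤ √(1 + ‖η‖ ^ 2) := Real.le_sqrt_of_sq_le (by linarith)
  have h3 : 1 ≤ 2 * Real.pi * √(1 + ‖η‖ ^ 2) := by nlinarith [Real.pi_gt_three]
  exact (pow_le_pow_left₀ (by positivity) (mul_le_mul_of_nonneg_left h2 (by positivity)) n).trans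
    (pow_le_pow_right₀ h3 hn)

end Polyharmonic

namespace Polyharmonic

/-! ### The unperturbed operator -/

/-- The transpose of `P_ζ(hD)` on Schwartz functions. -/
noncomputable def transP {d : ℕ} (ζ : Fin d → ℂ) (h : ℝ) : 𝓢(Eu d, ℂ) →ₗ[ℂ] 𝓢(Eu d, ℂ) :=
  (-(h : ℂ) ^ 2) • (laplacianCLM ℂ (Eu d) 𝓢(Eu d, ℂ)).toLinearMap
    + (2 * (h : ℂ)) • ∑ j, ζ j •
      (lineDerivOpCLM ℂ 𝓢(Eu d, ℂ) (EuclideanSpace.single j (1 : ℝ) : Eu d)).toLinearMap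

theorem transP_apply {d : ℕ} (ζ : Fin d → ℂ) (h : ℝ) (v : 𝓢(Eu d, ℂ)) :
    transP ζ h v = (-(h : ℂ) ^ 2) • Δ v
      + (2 * (h : ℂ)) • ∑ j, ζ j • ∂_{(EuclideanSpace.single j (1 : ℝ) : Eu d)} v := by
  simp [transP, SchwartzMap.laplacianCLM_eq]

theorem opP_apply {d : ℕ} (ζ : Fin d → ℂ) (h : ℝ) (u : TD d) (v : 𝓢(Eu d, ℂ)) :
    opP ζ h u v = u (transP ζ h v) := by
  have hsum : (∑ j, ζ j • D j u) v = ∑ j, ζ j * D j u v := by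
    change (PointwiseConvergenceCLM.evalCLM (RingHom.id ℂ) ℂ v) (∑ j, ζ j • D j u) = _
    rw [map_sum]
    rfl
  have h1 : opP ζ h u v = (h : ℂ) ^ 2 * (-(u (Δ v)))
      - (2 * Complex.I * (h : ℂ)) * (∑ j, ζ j • D j u) v := by
    rw [← TemperedDistribution.laplacian_apply_apply]
    rfl
  rw [h1, hsum, transP_apply, map_add, map_smul, map_smul, map_sum]
  simp only [D_apply, map_smul, smul_eq_mul, Finset.mul_sum]
  rw [sub_eq_add_neg, ← Finset.sum_neg_distrib]
  congr 1
  · ring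
  · refine Finset.sum_congr rfl fun j _ => ?_
    linear_combination (-2 * (h : ℂ) * ζ j *
      u (∂_{(EuclideanSpace.single j (1 : ℝ) : Eu d)} v)) * Complex.I_sq

theorem iterate_opP_apply {d : ℕ} (ζ : Fin d → ℂ) (h : ℝ) (m : ℕ) (u : TD d) (v : 𝓢(Eu d, ℂ)) :
    ((opP ζ h)^[m] u) v = u ((transP ζ h)^[m] v) := by
  induction m generalizing v with
  | zero => rfl
  | succ m ih =>
    rw [Function.iterate_succ_apply', opP_apply, ih, Function.iterate_succ_apply]

theorem fourierInv_transP {d : ℕ} (ζ : Fin d → ℂ) (h : ℝ) (v : 𝓢(Eu d, ℂ)) (η : Eu d) :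
    𝓕⁻ (transP ζ h v) η = scaledSymbol ζ h η * 𝓕⁻ v η := by
  have hΔ : Δ v = ∑ j, ∂_{(EuclideanSpace.single j (1 : ℝ) : Eu d)}
      (∂_{(EuclideanSpace.single j (1 : ℝ) : Eu d)} v) := by
    simpa using SchwartzMap.laplacian_eq_sum (EuclideanSpace.basisFun (Fin d) ℝ) v
  let E : 𝓢(Eu d, ℂ) →ₗ[ℂ] ℂ :=
    { toFun := fun w => (𝓕⁻ w : 𝓢(Eu d, ℂ)) η
      map_add' := fun w w' => by rw [FourierTransform.fourierInv_add]; rfl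
      map_smul' := fun c w => by rw [FourierTransform.fourierInv_smul]; rfl }
  have hE : ∀ w : 𝓢(Eu d, ℂ), 𝓕⁻ w η = E w := fun w => rfl
  have hd : ∀ (j : Fin d) (w : 𝓢(Eu d, ℂ)), E (∂_{(EuclideanSpace.single j (1 : ℝ) : Eu d)} w)
      = -(2 * Real.pi * Complex.I) * (η j : ℂ) * E w := fun j w => fourierInv_lineDeriv_single j w η
  rw [hE, hE, transP_apply, hΔ, map_add, map_smul, map_smul, map_sum, map_sum]
  simp only [hd, map_smul, smul_eq_mul]
  have hn : ((‖h • ((2 * Real.pi) • η)‖ ^ 2 : ℝ) : ℂ)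
      = (h : ℂ) ^ 2 * (2 * Real.pi) ^ 2 * ∑ j, (η j : ℂ) ^ 2 := by
    rw [norm_smul, norm_smul, mul_pow, mul_pow, EuclideanSpace.norm_sq_eq]
    simp only [Real.norm_eq_abs, sq_abs]
    push_cast
    ring
  rw [scaledSymbol, symbolP, hn, sub_mul, sub_eq_add_neg]
  simp only [Finset.mul_sum, Finset.sum_mul]
  rw [← Finset.sum_neg_distrib]
  congr 1
  · refine Finset.sum_congr rfl fun j _ => ?_
    linear_combination (-(h : ℂ) ^ 2 * (2 * Real.pi) ^ 2 * (η j : ℂ) ^ 2 * E v) * Complex.I_sq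
  · refine Finset.sum_congr rfl fun j _ => ?_
    simp only [PiLp.smul_apply, smul_eq_mul]
    push_cast
    ring

theorem fourierInv_iterate_transP {d : ℕ} (ζ : Fin d → ℂ) (h : ℝ) (m : ℕ) (v : 𝓢(Eu d, ℂ))
    (η : Eu d) : 𝓕⁻ ((transP ζ h)^[m] v) η = scaledSymbol ζ h η ^ m * 𝓕⁻ v η := by
  induction m generalizing v with
  | zero => simp
  | succ m ih =>
    rw [Function.iterate_succ_apply, ih, fourierInv_transP, pow_succ, mul_assoc]

/-- The elementary inequality that turns Poincaré's inequality into the a priori estimate, where `t`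
stands for `|P_ζ(hξ)| / h`. The term with the factor `L` integrates to a nonnegative quantity by
Poincaré's inequality; it compensates for the right-hand side being small at small `t`. -/
theorem exists_pointwise_bound {m : ℕ} (hm : 2 ≤ m) {a : ℝ} (ha : 0 < a) :
    ∃ c > 0, ∃ L > 0, ∀ t : ℝ, 0 ≤ t →
      c * (1 + t) ^ m + L * (a * t ^ 2 - 1) ≤ t ^ (2 * m) / (1 + t) ^ m := by
  set s := √(1 / (2 * a)) with hs
  have hs0 : 0 < s := Real.sqrt_pos.2 (by positivity)
  have hs2 : a * s ^ 2 = 1 / 2 := by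
    rw [hs, Real.sq_sqrt (by positivity)]
    field_simp
  set κ := s / (1 + s) with hκ
  have hκ0 : 0 < κ := by positivity
  set L := κ ^ (2 * m) / (2 * a) with hL
  have hL0 : 0 < L := by positivity
  refine ⟨min (κ ^ (2 * m) / 2) (L / 2 / (1 + s) ^ m), by positivity, L, hL0, fun t ht => ?_⟩
  have h1t : (1 : ℝ) ≤ 1 + t := by linarith
  rcases le_or_gt t s with hts | hts
  · -- for small `t` the left-hand side is nonpositive
    have h1 : min (κ ^ (2 * m) / 2) (L / 2 / (1 + s) ^ m) * (1 + t) ^ m ≤ L / 2 := by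
      calc _ ≤ L / 2 / (1 + s) ^ m * (1 + s) ^ m := by
            gcongr
            exact min_le_right _ _
        _ = L / 2 := by field_simp
    have h2 : a * t ^ 2 ≤ 1 / 2 := by
      rw [← hs2]
      gcongr
    have h3 : L * (a * t ^ 2 - 1) ≤ L * (-(1 / 2)) := by
      gcongr
      linarith
    have h4 : 0 ≤ t ^ (2 * m) / (1 + t) ^ m := by positivity
    linarith
  · have h1 : κ * (1 + t) ≤ t := by
      rw [hκ, div_mul_eq_mul_div, div_le_iff₀ (by positivity)]
      nlinarith
    have h2 : κ ^ (2 * m) * (1 + t) ^ m ≤ t ^ (2 * m) / (1 + t) ^ m := by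
      rw [le_div_iff₀ (by positivity), mul_assoc, ← pow_add, ← two_mul, ← mul_pow]
      exact pow_le_pow_left₀ (by positivity) h1 _
    have h3 : t ^ 2 ≤ (1 + t) ^ m :=
      (pow_le_pow_left₀ ht (by linarith) 2).trans (pow_le_pow_right₀ h1t hm)
    have h4 : L * (a * t ^ 2) ≤ κ ^ (2 * m) / 2 * (1 + t) ^ m := by
      calc L * (a * t ^ 2) ≤ L * (a * (1 + t) ^ m) := by gcongr
        _ = _ := by rw [hL]; field_simp
    have h5 : min (κ ^ (2 * m) / 2) (L / 2 / (1 + s) ^ m) * (1 + t) ^ m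
        ≤ κ ^ (2 * m) / 2 * (1 + t) ^ m := by
      gcongr
      exact min_le_left _ _
    nlinarith

theorem fourierInv_lineDeriv_apply {d : ℕ} (μ : Eu d) (v : 𝓢(Eu d, ℂ)) (η : Eu d) :
    𝓕⁻ (∂_{μ} v) η = -(2 * Real.pi * Complex.I) * (inner ℝ η μ : ℂ) * 𝓕⁻ v η := by
  rw [SchwartzMap.fourierInv_lineDerivOp_eq]
  have h : (inner ℝ · μ : Eu d → ℝ).HasTemperateGrowth := by fun_prop
  change (-(2 * Real.pi * Complex.I) : ℂ) • SchwartzMap.smulLeftCLM ℂ (inner ℝ · μ) (𝓕⁻ v) η = _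
  rw [SchwartzMap.smulLeftCLM_apply_apply h]
  simp
  ring

/-- The function `P_ζ(hξ)^m (h + |P_ζ(hξ)|)^{-m/2} 𝓕⁻v`. Its `L²` norm is the norm in the dual of
`X^{m/2}` of the transpose of `P_ζ(hD)^m` applied to `v`. -/
noncomputable def mainPart {d : ℕ} (ζ : Fin d → ℂ) (h : ℝ) (m : ℕ) (v : 𝓢(Eu d, ℂ)) (η : Eu d) : ℂ :=
  scaledSymbol ζ h η ^ m * ((xWeight ζ h m η)⁻¹ : ℝ) * 𝓕⁻ v η

theorem norm_mainPart {d : ℕ} {ζ : Fin d → ℂ} (hζ : ζ ∈ zetaSet d) {h : ℝ} (hh : 0 < h) (m : ℕ)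
    (v : 𝓢(Eu d, ℂ)) (η : Eu d) : ‖mainPart ζ h m v η‖ =
      ‖scaledSymbol ζ h η‖ ^ m * (xWeight ζ h m η)⁻¹ * ‖𝓕⁻ v η‖ := by
  rw [mainPart, norm_mul, norm_mul, norm_pow, Complex.norm_real,
    Real.norm_of_nonneg (inv_nonneg.2 ((isWeight_xWeight hζ hh m).pos η).le)]

theorem xWeight_sq {d : ℕ} (ζ : Fin d → ℂ) {h : ℝ} (hh : 0 < h) (m : ℕ) (η : Eu d) :
    xWeight ζ h m η ^ 2 = (h + ‖scaledSymbol ζ h η‖) ^ m := by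
  rw [xWeight, ← pow_mul, mul_comm m 2, pow_mul, Real.sq_sqrt (by positivity)]

theorem memLp_mainPart {d : ℕ} {ζ : Fin d → ℂ} (hζ : ζ ∈ zetaSet d) {h : ℝ} (hh : 0 < h) (m : ℕ)
    (v : 𝓢(Eu d, ℂ)) : MemLp (mainPart ζ h m v) 2 volume := by
  have hω := isWeight_xWeight hζ hh m
  refine (hω.memLp (𝓕⁻ v)).of_le ?_ (Eventually.of_forall fun η => ?_)
  · have h1 := continuous_scaledSymbol ζ h
    have h2 : Continuous (𝓕⁻ v : 𝓢(Eu d, ℂ)) := (𝓕⁻ v).continuous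
    have h3 : Continuous fun η => (xWeight ζ h m η)⁻¹ := hω.continuous.inv₀ fun η => (hω.pos η).ne'
    unfold mainPart
    exact (by fun_prop : Continuous fun η =>
      scaledSymbol ζ h η ^ m * ((xWeight ζ h m η)⁻¹ : ℝ) * 𝓕⁻ v η).aestronglyMeasurable
  · rw [norm_mainPart hζ hh, norm_mul, Complex.norm_real, Real.norm_of_nonneg (hω.pos η).le]
    refine mul_le_mul_of_nonneg_right ?_ (norm_nonneg _)
    rw [← div_eq_mul_inv, div_le_iff₀ (hω.pos η), ← sq, xWeight_sq ζ hh]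
    exact pow_le_pow_left₀ (norm_nonneg _) (by linarith) m

/-- The a priori estimate for the unperturbed operator and functions supported in a ball. -/
theorem exists_apriori {d m : ℕ} (hm : 2 ≤ m) {R : ℝ} (hR : 0 < R) :
    ∃ c > 0, ∀ ζ (hζ : ζ ∈ zetaSet d) (h : ℝ) (hh : 0 < h) (v : 𝓢(Eu d, ℂ)),
      (∀ x, v x ≠ 0 → ‖x‖ ≤ R) →
      c * ‖weightFourierInv (isWeight_xWeight hζ hh m) v‖
        ≤ ‖(memLp_mainPart hζ hh m v).toLp _‖ := by
  obtain ⟨c, hc, L, hL, hpt⟩ := exists_pointwise_bound hm (a := R ^ 2) (by positivity)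
  refine ⟨√c, by positivity, fun ζ hζ h hh v hv => ?_⟩
  have hω := isWeight_xWeight hζ hh m
  obtain ⟨μ₁, μ₂, h1, h2, h12, hζ'⟩ := id hζ
  set V : Eu d → ℝ := fun η => ‖𝓕⁻ v η‖ ^ 2 with hV
  set t : Eu d → ℝ := fun η => ‖scaledSymbol ζ h η‖ / h with ht
  have ht0 : ∀ η, 0 ≤ t η := fun η => by positivity
  have htc : Continuous t := (continuous_scaledSymbol ζ h).norm.div_const h
  have hVc : Continuous V := (𝓕⁻ v).continuous.norm.pow 2
  have hh' : ∀ η, h + ‖scaledSymbol ζ h η‖ = h * (1 + t η) := fun η => by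
    rw [ht]; field_simp
  have hn' : ∀ η, ‖scaledSymbol ζ h η‖ = h * t η := fun η => by
    rw [ht]; field_simp
  have hω2 : ∀ η, ‖(xWeight ζ h m η : ℂ) * 𝓕⁻ v η‖ ^ 2 = h ^ m * ((1 + t η) ^ m * V η) := fun η => by
    rw [norm_mul, Complex.norm_real, Real.norm_of_nonneg (hω.pos η).le, mul_pow, xWeight_sq ζ hh,
      hh', mul_pow]
    ring
  have hm2 : ∀ η, ‖mainPart ζ h m v η‖ ^ 2 = h ^ m * (t η ^ (2 * m) / (1 + t η) ^ m * V η) := by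
    intro η
    have : (1 + t η) ≠ 0 := by have := ht0 η; positivity
    rw [norm_mainPart hζ hh, mul_pow, mul_pow, inv_pow, xWeight_sq ζ hh, hh', hn',
      mul_pow h, mul_pow h]
    change _ = h ^ m * (t η ^ (2 * m) / (1 + t η) ^ m * ‖𝓕⁻ v η‖ ^ 2)
    field_simp
    ring
  have hi1 : Integrable fun η => (1 + t η) ^ m * V η := by
    have := ((hω.memLp (𝓕⁻ v)).integrable_norm_pow (by norm_num)).const_mul ((h ^ m)⁻¹)
    refine this.congr (Eventually.of_forall fun η => ?_)
    beta_reduce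
    rw [hω2]
    field_simp
  have hi2 : Integrable fun η => t η ^ (2 * m) / (1 + t η) ^ m * V η := by
    have := ((memLp_mainPart hζ hh m v).integrable_norm_pow (by norm_num)).const_mul ((h ^ m)⁻¹)
    refine this.congr (Eventually.of_forall fun η => ?_)
    beta_reduce
    rw [hm2]
    field_simp
  have hdom : ∀ (f : Eu d → ℝ), Continuous f → (∀ η, |f η| ≤ (1 + t η) ^ m) →
      Integrable fun η => f η * V η := fun f hf hle => by
    refine hi1.mono' (hf.mul hVc).aestronglyMeasurable (Eventually.of_forall fun η => ?_)
    rw [Real.norm_eq_abs, abs_mul, abs_of_nonneg (by positivity : 0 ≤ V η)]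
    exact mul_le_mul_of_nonneg_right (hle η) (by positivity)
  have hi3 : Integrable fun η => t η ^ 2 * V η := hdom _ (htc.pow 2) fun η => by
    rw [abs_of_nonneg (by positivity)]
    exact (pow_le_pow_left₀ (ht0 η) (by linarith) 2).trans
      (pow_le_pow_right₀ (by linarith [ht0 η]) hm)
  have hi4 : Integrable V := by
    simpa using hdom (fun _ => 1) continuous_const fun η => by
      rw [abs_one]
      exact one_le_pow₀ (by linarith [ht0 η])
  -- Poincaré's inequality on the Fourier side
  have hP : ∫ η, V η ≤ R ^ 2 * ∫ η, t η ^ 2 * V η := by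
    have hpo := norm_le_mul_norm_lineDeriv hR.le μ₁ h1 v hv
    have hsq := pow_le_pow_left₀ (norm_nonneg _) hpo 2
    rw [mul_pow, ← norm_fourierInv_toLp_two v, ← norm_fourierInv_toLp_two (∂_{μ₁} v),
      norm_toLp_two_sq, norm_toLp_two_sq] at hsq
    refine hsq.trans ?_
    have hle : ∫ η, ‖𝓕⁻ (∂_{μ₁} v : 𝓢(Eu d, ℂ)) η‖ ^ 2 ≤ ∫ η, (1 / 4) * (t η ^ 2 * V η) := by
      refine integral_mono ((𝓕⁻ (∂_{μ₁} v : 𝓢(Eu d, ℂ))).memLp 2 |>.integrable_norm_pow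
        (by norm_num)) (hi3.const_mul _) fun η => ?_
      have hle1 := abs_inner_le_symbolP hζ' (h • ((2 * Real.pi) • η))
      rw [inner_smul_right, inner_smul_right, abs_mul, abs_mul, abs_of_pos hh,
        abs_of_pos (by positivity : 0 < 2 * Real.pi), ← scaledSymbol, hn'] at hle1
      have hle2 : 2 * Real.pi * |inner ℝ μ₁ η| ≤ t η / 2 := by
        have : h * (2 * (2 * Real.pi * |inner ℝ μ₁ η|)) ≤ h * t η := by linarith
        have := le_of_mul_le_mul_left this hh
        linarith
      beta_reduce
      rw [fourierInv_lineDeriv_apply, norm_mul, mul_pow, ← mul_assoc]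
      refine mul_le_mul_of_nonneg_right ?_ (by positivity)
      have hne : ‖-(2 * Real.pi * Complex.I) * (inner ℝ η μ₁ : ℂ)‖ = 2 * Real.pi * |inner ℝ μ₁ η| := by
        rw [norm_mul, norm_neg, norm_mul, norm_mul, Complex.norm_I, mul_one, Complex.norm_real,
          Complex.norm_ofNat, Complex.norm_real, Real.norm_of_nonneg Real.pi_pos.le,
          Real.norm_eq_abs, real_inner_comm]
      rw [hne]
      refine (pow_le_pow_left₀ (by positivity) hle2 2).trans (le_of_eq (by ring))
    rw [integral_const_mul] at hle
    calc _ ≤ (2 * R) ^ 2 * (1 / 4 * ∫ η, t η ^ 2 * V η) := by gcongr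
      _ = _ := by ring
  have hmain : c * ∫ η, (1 + t η) ^ m * V η ≤ ∫ η, t η ^ (2 * m) / (1 + t η) ^ m * V η := by
    have hi5 : Integrable fun η => L * R ^ 2 * (t η ^ 2 * V η) - L * V η :=
      (hi3.const_mul _).sub (hi4.const_mul L)
    have hmono : ∫ η, (c * ((1 + t η) ^ m * V η) + (L * R ^ 2 * (t η ^ 2 * V η) - L * V η))
        ≤ ∫ η, t η ^ (2 * m) / (1 + t η) ^ m * V η := by
      refine integral_mono ((hi1.const_mul c).add hi5) hi2
        fun η => ?_
      have := mul_le_mul_of_nonneg_right (hpt (t η) (ht0 η)) (by positivity : 0 ≤ V η)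
      refine le_trans (le_of_eq ?_) this
      ring
    rw [integral_add (hi1.const_mul c) hi5,
      integral_sub (hi3.const_mul _) (hi4.const_mul L),
      integral_const_mul, integral_const_mul,
      integral_const_mul] at hmono
    have := mul_le_mul_of_nonneg_left hP hL.le
    nlinarith
  have hfin : (√c * ‖weightFourierInv hω v‖) ^ 2 ≤ ‖(memLp_mainPart hζ hh m v).toLp _‖ ^ 2 := by
    have e1 : ‖weightFourierInv hω v‖ ^ 2 = ∫ η, ‖(xWeight ζ h m η : ℂ) * 𝓕⁻ v η‖ ^ 2 :=
      sq_norm_toLp (hω.memLp (𝓕⁻ v))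
    rw [mul_pow, Real.sq_sqrt hc.le, e1, sq_norm_toLp]
    simp only [hω2, hm2]
    rw [integral_const_mul, integral_const_mul]
    have := mul_le_mul_of_nonneg_left hmain (by positivity : 0 ≤ h ^ m)
    linarith
  exact le_of_sq_le_sq hfin (norm_nonneg _)

end Polyharmonic

namespace Polyharmonic

/-! ### The perturbation -/

theorem sum_TD_apply {d : ℕ} {ι : Type*} (s : Finset ι) (T : ι → TD d) (v : 𝓢(Eu d, ℂ)) :
    (∑ i ∈ s, T i) v = ∑ i ∈ s, T i v := by
  change (PointwiseConvergenceCLM.evalCLM (RingHom.id ℂ) ℂ v) (∑ i ∈ s, T i) = _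
  rw [map_sum]
  rfl

/-- A sum of derivatives of order at most `k` of bounded functions acts on products of `W^{k,2}`
functions. -/
theorem norm_sum_Dpow_mul_le {d k : ℕ} {θ M : ℝ≥0} (hθ : 0 < θ) {g : (Fin d → ℕ) → Eu d → ℂ}
    (hg : ∀ β ∈ multiIndices d k, holderENorm θ (g β) ≤ M) (φ ψ : 𝓢(Eu d, ℂ)) :
    ‖(∑ β ∈ multiIndices d k, Dpow β (ofBounded (g β))) (SchwartzMap.smulLeftCLM ℂ φ ψ)‖ ≤
      (multiIndices d k).card * (M * (2 ^ k * ((2 * Real.pi) ^ k) ^ 2)) *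
        (‖weightFourier (isWeight_besselWeight k) φ‖ *
          ‖weightFourierInv (isWeight_besselWeight k) ψ‖) := by
  rw [sum_TD_apply, mul_assoc, ← nsmul_eq_mul]
  refine norm_sum_le_of_le _ (fun β hβ => ?_) |>.trans_eq (Finset.sum_const _)
  have hβ' := (mem_multiIndices β).1 hβ
  refine (norm_Dpow_ofBounded_mul_le (τ := 1) hθ (hg β hβ) zero_le_one
    (A := (2 * Real.pi) ^ k * ‖weightFourier (isWeight_besselWeight k) φ‖)
    (B := (2 * Real.pi) ^ k * ‖weightFourierInv (isWeight_besselWeight k) ψ‖)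
    (by positivity) (by positivity) β hβ' φ ψ (fun l hl => ?_) fun l hl => ?_).trans ?_
  · refine (norm_iterDeriv_le_fourier (isWeight_besselWeight k) l
      (fun η => pow_le_besselWeight hl η) φ).trans (le_of_eq ?_)
    rw [weightFourier_apply]
    ring
  · refine (norm_iterDeriv_le_fourierInv (isWeight_besselWeight k) l
      (fun η => pow_le_besselWeight hl η) ψ).trans (le_of_eq ?_)
    rw [weightFourierInv_apply]
    ring
  · have : (2 * 1 : ℝ) ^ (∑ j, β j) ≤ 2 ^ k := by
      rw [mul_one]
      exact pow_le_pow_right₀ one_le_two hβ'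
    calc _ ≤ (M : ℝ) * (2 ^ k * ((2 * Real.pi) ^ k * ‖weightFourier (isWeight_besselWeight k) φ‖ *
          ((2 * Real.pi) ^ k * ‖weightFourierInv (isWeight_besselWeight k) ψ‖))) := by
          gcongr
      _ = _ := by ring

theorem norm_sum_Dpow_mul_le_gain {d k : ℕ} {θ M : ℝ≥0} (hθ : 0 < θ) (hθ1 : θ ≤ 1)
    {g : (Fin d → ℕ) → Eu d → ℂ} (hg : ∀ β ∈ multiIndices d k, holderENorm θ (g β) ≤ M)
    {h : ℝ} (hh : 0 < h) (hh1 : h ≤ 1) (hk : 1 ≤ k) {A B : ℝ} (hA : 0 ≤ A) (hB : 0 ≤ B)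
    (φ ψ : 𝓢(Eu d, ℂ))
    (hφ : ∀ l' : List (Fin d), l'.length ≤ k →
      ‖((iterDeriv l' φ).toLp 2 : Lp ℂ 2 (volume : Measure (Eu d)))‖ ≤ A * h⁻¹ ^ l'.length)
    (hψ : ∀ l' : List (Fin d), l'.length ≤ k →
      ‖((iterDeriv l' ψ).toLp 2 : Lp ℂ 2 (volume : Measure (Eu d)))‖ ≤ B * h⁻¹ ^ l'.length) :
    ‖(∑ β ∈ multiIndices d k, Dpow β (ofBounded (g β))) (SchwartzMap.smulLeftCLM ℂ φ ψ)‖ ≤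
      (multiIndices d k).card * (2 * M * √h ^ (θ : ℝ) * ((2 * h⁻¹) ^ k * (A * B))) := by
  rw [sum_TD_apply, ← nsmul_eq_mul]
  refine norm_sum_le_of_le _ (fun β hβ => ?_) |>.trans_eq (Finset.sum_const _)
  exact norm_Dpow_ofBounded_mul_le_gain hθ hθ1 (hg β hβ) hh hh1 hk hA hB β
    ((mem_multiIndices β).1 hβ) φ ψ hφ hψ

/-- The operator `ζ_j / (ih) + D_j` on Schwartz functions. -/
noncomputable def shiftD {d : ℕ} (ζ : Fin d → ℂ) (h : ℝ) (j : Fin d) :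
    𝓢(Eu d, ℂ) →ₗ[ℂ] 𝓢(Eu d, ℂ) :=
  (ζ j / (Complex.I * (h : ℂ))) • LinearMap.id + (-Complex.I) •
    (lineDerivOpCLM ℂ 𝓢(Eu d, ℂ) (EuclideanSpace.single j (1 : ℝ) : Eu d)).toLinearMap

theorem shiftD_apply {d : ℕ} (ζ : Fin d → ℂ) (h : ℝ) (j : Fin d) (φ : 𝓢(Eu d, ℂ)) :
    shiftD ζ h j φ = (ζ j / (Complex.I * (h : ℂ))) • φ
      + (-Complex.I) • ∂_{(EuclideanSpace.single j (1 : ℝ) : Eu d)} φ := by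
  simp [shiftD]

theorem fourier_shiftD {d : ℕ} (ζ : Fin d → ℂ) (h : ℝ) (j : Fin d) (φ : 𝓢(Eu d, ℂ)) (η : Eu d) :
    𝓕 (shiftD ζ h j φ) η = (ζ j / (Complex.I * (h : ℂ)) + 2 * Real.pi * η j) * 𝓕 φ η := by
  rw [shiftD_apply, FourierTransform.fourier_add, FourierTransform.fourier_smul,
    FourierTransform.fourier_smul]
  change (ζ j / (Complex.I * (h : ℂ))) * 𝓕 φ η + (-Complex.I) *
    𝓕 (∂_{(EuclideanSpace.single j (1 : ℝ) : Eu d)} φ) η = _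
  rw [fourier_lineDeriv_single]
  linear_combination (-2 * Real.pi * (η j : ℂ) * 𝓕 φ η) * Complex.I_sq

theorem norm_iterDeriv_shiftD_le {d m : ℕ} {ζ : Fin d → ℂ} (hζ : ζ ∈ zetaSet d) {h : ℝ}
    (hh : 0 < h) (j : Fin d) {A : ℝ} (φ : 𝓢(Eu d, ℂ))
    (hφ : ∀ l' : List (Fin d), l'.length ≤ m →
      ‖((iterDeriv l' φ).toLp 2 : Lp ℂ 2 (volume : Measure (Eu d)))‖ ≤ A * h⁻¹ ^ l'.length)
    (l : List (Fin d)) (hl : l.length + 1 ≤ m) :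
    ‖((iterDeriv l (shiftD ζ h j φ)).toLp 2 : Lp ℂ 2 (volume : Measure (Eu d)))‖
      ≤ 3 * A * h⁻¹ * h⁻¹ ^ l.length := by
  have h1 := hφ l (by omega)
  have h2 := hφ (j :: l) (by simpa using hl)
  rw [iterDeriv_cons, List.length_cons, pow_succ] at h2
  have hlin : ∀ (a b : ℂ) (F G : 𝓢(Eu d, ℂ)),
      ((a • F + b • G).toLp 2 : Lp ℂ 2 (volume : Measure (Eu d)))
        = a • F.toLp 2 volume + b • G.toLp 2 volume := by
    intro a b F G
    have := (SchwartzMap.toLpCLM ℂ ℂ 2 (volume : Measure (Eu d))).map_add (a • F) (b • G)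
    rw [map_smul, map_smul] at this
    exact this
  rw [shiftD_apply, iterDeriv_add, iterDeriv_smul, iterDeriv_smul, hlin]
  refine (norm_add_le _ _).trans ?_
  rw [norm_smul, norm_smul, norm_neg, Complex.norm_I, one_mul, norm_div, norm_mul, Complex.norm_I,
    one_mul, Complex.norm_real, Real.norm_of_nonneg hh.le, div_eq_mul_inv]
  have hc : ‖ζ j‖ * h⁻¹ ≤ 2 * h⁻¹ := by
    gcongr
    exact norm_apply_le_of_mem_zetaSet hζ j
  have := mul_le_mul hc h1 (norm_nonneg _) (by positivity)
  linarith

/-- The bilinear form of the lower order terms of `L_ζ`. -/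
noncomputable def pertForm {d : ℕ} (m : ℕ) (Q : Fin d → TD d) (q : TD d) (ζ : Fin d → ℂ) (h : ℝ) :
    𝓢(Eu d, ℂ) →ₗ[ℂ] 𝓢(Eu d, ℂ) →ₗ[ℂ] ℂ :=
  ((h : ℂ) ^ (2 * m)) • ∑ j, ((schwartzMul ∘ₗ shiftD ζ h j).compr₂ (Q j).toLinearMap).flip
    + ((h : ℂ) ^ (2 * m)) • (schwartzMul.compr₂ q.toLinearMap).flip

theorem pertForm_apply {d : ℕ} (m : ℕ) (Q : Fin d → TD d) (q : TD d) (ζ : Fin d → ℂ) (h : ℝ)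
    (v φ : 𝓢(Eu d, ℂ)) : pertForm m Q q ζ h v φ =
      (h : ℂ) ^ (2 * m) * ∑ j, Q j (SchwartzMap.smulLeftCLM ℂ (shiftD ζ h j φ) v)
        + (h : ℂ) ^ (2 * m) * q (SchwartzMap.smulLeftCLM ℂ φ v) := by
  simp [pertForm, LinearMap.sum_apply, schwartzMul_apply]
  rfl

theorem norm_pertForm_le_of_norm_iterDeriv_le {d m : ℕ} (hm : 1 ≤ m) {θ M : ℝ≥0} (hθ : 0 < θ)
    (hθ1 : θ ≤ 1) {Qp : Fin d → (Fin d → ℕ) → Eu d → ℂ} {qp : (Fin d → ℕ) → Eu d → ℂ}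
    (hQ : ∀ j, ∀ β ∈ multiIndices d m, holderENorm θ (Qp j β) ≤ M)
    (hq : ∀ β ∈ multiIndices d (m + 1), holderENorm θ (qp β) ≤ M)
    {ζ : Fin d → ℂ} (hζ : ζ ∈ zetaSet d) {h : ℝ} (hh : 0 < h) (hh1 : h ≤ 1) (v φ : 𝓢(Eu d, ℂ))
    {A B : ℝ} (hA : 0 ≤ A) (hB : 0 ≤ B)
    (hφ : ∀ l : List (Fin d), l.length ≤ m + 1 →
      ‖((iterDeriv l φ).toLp 2 : Lp ℂ 2 (volume : Measure (Eu d)))‖ ≤ A * h⁻¹ ^ l.length)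
    (hv : ∀ l : List (Fin d), l.length ≤ m + 1 →
      ‖((iterDeriv l v).toLp 2 : Lp ℂ 2 (volume : Measure (Eu d)))‖ ≤ B * h⁻¹ ^ l.length) :
    ‖pertForm (m + 1) (fun j => ∑ β ∈ multiIndices d m, Dpow β (ofBounded (Qp j β)))
      (∑ β ∈ multiIndices d (m + 1), Dpow β (ofBounded (qp β))) ζ h v φ‖ ≤
      (3 * d * (multiIndices d m).card + (multiIndices d (m + 1)).card) *
        (2 * M * √h ^ (θ : ℝ)) * (h ^ (2 * (m + 1)) * (2 * h⁻¹) ^ (m + 1) * (A * B)) := by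
  have hQb : ∀ j, ‖(∑ β ∈ multiIndices d m, Dpow β (ofBounded (Qp j β)))
      (SchwartzMap.smulLeftCLM ℂ (shiftD ζ h j φ) v)‖ ≤
      (multiIndices d m).card * (2 * M * √h ^ (θ : ℝ) * ((2 * h⁻¹) ^ m * (3 * A * h⁻¹ * B))) :=
    fun j => norm_sum_Dpow_mul_le_gain hθ hθ1 (hQ j) hh hh1 hm
      (mul_nonneg (mul_nonneg (by norm_num) hA) (inv_nonneg.2 hh.le)) hB (shiftD ζ h j φ) v
      (fun l hl => norm_iterDeriv_shiftD_le hζ hh j φ hφ l (Nat.succ_le_succ hl))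
      fun l hl => hv l (hl.trans (Nat.le_succ m))
  have hqb := norm_sum_Dpow_mul_le_gain (k := m + 1) (A := A) (B := B) hθ hθ1 hq hh hh1
    (Nat.le_add_left 1 m) hA hB φ v hφ hv
  rw [pertForm_apply]
  refine (norm_add_le _ _).trans ?_
  rw [norm_mul, norm_mul, norm_pow, Complex.norm_real, Real.norm_of_nonneg hh.le]
  have hsum := (norm_sum_le _ _).trans (Finset.sum_le_card_nsmul Finset.univ _ _
    (fun j _ => hQb j))
  rw [Finset.card_univ, Fintype.card_fin, nsmul_eq_mul] at hsum
  have hh' : 0 ≤ h⁻¹ := inv_nonneg.2 hh.le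
  have h0 : 0 ≤ h ^ (2 * (m + 1)) := by positivity
  -- the factor `2 ^ m` is only rounded up to `2 ^ (m + 1)`
  have h2 : (2 * h⁻¹) ^ m * h⁻¹ ≤ (2 * h⁻¹) ^ (m + 1) := by
    rw [pow_succ]
    exact mul_le_mul_of_nonneg_left (by linarith) (by positivity)
  refine (add_le_add (mul_le_mul_of_nonneg_left hsum h0)
    (mul_le_mul_of_nonneg_left hqb h0)).trans ?_
  have h3 : 0 ≤ h ^ (2 * (m + 1)) * (d * ((multiIndices d m).card *
    (2 * M * √h ^ (θ : ℝ) * (3 * A * B)))) := by positivity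
  have := mul_le_mul_of_nonneg_left h2 h3
  refine le_trans (le_of_eq ?_) ((add_le_add_left this (h ^ (2 * (m + 1)) *
    ((multiIndices d (m + 1)).card *
      (2 * M * √h ^ (θ : ℝ) * ((2 * h⁻¹) ^ (m + 1) * (A * B)))))).trans (le_of_eq ?_))
  · ring
  · ring

/-- The lower order terms of `L_ζ` are small from `X^{m/2}` to `X^{-m/2}` as `h → 0`, uniformly with
respect to `ζ`. -/
theorem norm_pertForm_le {d m : ℕ} (hm : 1 ≤ m) {θ M : ℝ≥0} (hθ : 0 < θ) (hθ1 : θ ≤ 1)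
    {Qp : Fin d → (Fin d → ℕ) → Eu d → ℂ} {qp : (Fin d → ℕ) → Eu d → ℂ}
    (hQ : ∀ j, ∀ β ∈ multiIndices d m, holderENorm θ (Qp j β) ≤ M)
    (hq : ∀ β ∈ multiIndices d (m + 1), holderENorm θ (qp β) ≤ M)
    {ζ : Fin d → ℂ} (hζ : ζ ∈ zetaSet d) {h : ℝ} (hh : 0 < h) (hh1 : h ≤ 1) (v φ : 𝓢(Eu d, ℂ)) :
    ‖pertForm (m + 1) (fun j => ∑ β ∈ multiIndices d m, Dpow β (ofBounded (Qp j β)))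
      (∑ β ∈ multiIndices d (m + 1), Dpow β (ofBounded (qp β))) ζ h v φ‖ ≤
      (3 * d * (multiIndices d m).card + (multiIndices d (m + 1)).card) *
        (2 * M * √h ^ (θ : ℝ)) * 128 ^ (m + 1) *
        (‖weightFourier (isWeight_xWeight hζ hh (m + 1)) φ‖ *
          ‖weightFourierInv (isWeight_xWeight hζ hh (m + 1)) v‖) := by
  have hs : 0 < √h := Real.sqrt_pos.2 hh
  have hK0 : 0 ≤ (8 : ℝ) ^ (m + 1) * (√h ^ (m + 1))⁻¹ := by positivity
  refine (norm_pertForm_le_of_norm_iterDeriv_le hm hθ hθ1 hQ hq hζ hh hh1 v φ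
    (A := (8 : ℝ) ^ (m + 1) * (√h ^ (m + 1))⁻¹ *
      ‖weightFourier (isWeight_xWeight hζ hh (m + 1)) φ‖)
    (B := (8 : ℝ) ^ (m + 1) * (√h ^ (m + 1))⁻¹ *
      ‖weightFourierInv (isWeight_xWeight hζ hh (m + 1)) v‖)
    (mul_nonneg hK0 (norm_nonneg _)) (mul_nonneg hK0 (norm_nonneg _))
    (fun l hl => ?_) fun l hl => ?_).trans (le_of_eq ?_)
  · refine (norm_iterDeriv_le_fourier (isWeight_xWeight hζ hh (m + 1)) l
      (fun η => pow_le_xWeight hζ hh hh1 hl η) φ).trans (le_of_eq ?_)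
    rw [weightFourier_apply]
    ring
  · refine (norm_iterDeriv_le_fourierInv (isWeight_xWeight hζ hh (m + 1)) l
      (fun η => pow_le_xWeight hζ hh hh1 hl η) v).trans (le_of_eq ?_)
    rw [weightFourierInv_apply]
    ring
  -- all powers of `h` cancel
  have hcancel : h ^ (2 * (m + 1)) * (2 * h⁻¹) ^ (m + 1) *
      ((8 : ℝ) ^ (m + 1) * (√h ^ (m + 1))⁻¹ * ((8 : ℝ) ^ (m + 1) * (√h ^ (m + 1))⁻¹))
      = 128 ^ (m + 1) := by
    calc _ = ((h * h * (2 * h⁻¹)) * (8 * (√h)⁻¹ * (8 * (√h)⁻¹))) ^ (m + 1) := by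
          simp only [mul_pow, inv_pow, two_mul, pow_add]
          ring
      _ = (h * h * (2 * h⁻¹) * (64 * (√h * √h)⁻¹)) ^ (m + 1) := by
          rw [mul_inv]
          ring
      _ = 128 ^ (m + 1) := by
          rw [Real.mul_self_sqrt hh.le]
          congr 1
          field_simp
          norm_num
  rw [← hcancel]
  ring

end Polyharmonic

namespace Polyharmonic

/-! ### The norms of `X^{m/2}` and `X^{-m/2}` -/

theorem IsFunction.ae_eq {d : ℕ} {T : TD d} {g g' : Eu d → ℂ} (hg : IsFunction T g)
    (hg' : IsFunction T g') : g =ᵐ[volume] g' := by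
  refine ae_eq_of_integral_contDiff_smul_eq hg.1 hg'.1 fun w hw hws => ?_
  have hg₁ : HasCompactSupport (Complex.ofRealCLM ∘ w) := hws.comp_left rfl
  have hg₂ : ContDiff ℝ ((⊤ : ℕ∞) : WithTop ℕ∞) (Complex.ofRealCLM ∘ w) := by fun_prop
  have h1 : HasCompactSupport (hg₁.toSchwartzMap hg₂) := hg₁
  exact (hg.2 _ h1).symm.trans (hg'.2 _ h1)

/-- The Jacobian of `η ↦ 2πη`, which appears in the norm of `X^λ` when it is expressed in Mathlib's
normalization of the Fourier transform. -/
noncomputable def jacobian (d : ℕ) : ℝ≥0∞ :=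
  ENNReal.ofReal |(((2 * Real.pi)⁻¹ ^ Module.finrank ℝ (Eu d))⁻¹ : ℝ)|

theorem lintegral_comp_two_pi_smul {d : ℕ} (F : Eu d → ℝ≥0∞) :
    ∫⁻ ξ : Eu d, F ((2 * Real.pi)⁻¹ • ξ) = jacobian d * ∫⁻ η, F η := by
  have h0 : (2 * Real.pi)⁻¹ ≠ 0 := by positivity
  have h := lintegral_map_equiv (μ := (volume : Measure (Eu d))) F (MeasurableEquiv.smul₀ _ h0)
  rw [MeasurableEquiv.coe_smul₀, Measure.map_addHaar_smul _ h0, lintegral_smul_measure] at h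
  exact h.symm

theorem jacobian_mul_eLpNorm_eq {d : ℕ} {w : Eu d → ℝ} (hw : ∀ η, 0 ≤ w η) (g : Eu d → ℂ) :
    jacobian d ^ (1 / 2 : ℝ) * eLpNorm (fun η => (w η : ℂ) * g η) 2 volume
      = (∫⁻ ξ : Eu d, ‖g ((2 * Real.pi)⁻¹ • ξ)‖ₑ ^ 2 *
        ENNReal.ofReal (w ((2 * Real.pi)⁻¹ • ξ) ^ 2)) ^ (1 / 2 : ℝ) := by
  rw [lintegral_comp_two_pi_smul (fun η => ‖g η‖ₑ ^ 2 * ENNReal.ofReal (w η ^ 2)),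
    ENNReal.mul_rpow_of_nonneg _ _ (by norm_num),
    eLpNorm_eq_lintegral_rpow_enorm_toReal (by norm_num) (by norm_num)]
  simp only [ENNReal.toReal_ofNat, ENNReal.rpow_ofNat]
  congr 3 with η
  rw [enorm_mul, mul_pow, mul_comm, ENNReal.ofReal_pow (hw η), ← ofReal_norm (w η : ℂ),
    Complex.norm_real, Real.norm_of_nonneg (hw η)]

/-- The expression in the definition of the norm of `X^μ`, in Mathlib's normalization. -/
theorem xNorm_integrand_eq {d : ℕ} (ζ : Fin d → ℂ) (h μ : ℝ) {w : Eu d → ℝ} (hw : ∀ η, 0 ≤ w η)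
    (hμ : ∀ η, (h + ‖scaledSymbol ζ h η‖) ^ (2 * μ) = w η ^ 2) (g : Eu d → ℂ) :
    (∫⁻ ξ : Eu d, ‖g ((2 * Real.pi)⁻¹ • ξ)‖ₑ ^ 2 *
      ENNReal.ofReal ((h + ‖symbolP ζ (h • ξ)‖) ^ (2 * μ))) ^ (1 / 2 : ℝ) =
    jacobian d ^ (1 / 2 : ℝ) * eLpNorm (fun η => (w η : ℂ) * g η) 2 volume := by
  rw [jacobian_mul_eLpNorm_eq hw]
  congr 3 with ξ
  rw [← hμ, scaledSymbol, smul_inv_smul₀ (by positivity)]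

theorem rpow_eq_xWeight_sq {d : ℕ} (ζ : Fin d → ℂ) {h : ℝ} (hh : 0 < h) (m : ℕ) (η : Eu d) :
    (h + ‖scaledSymbol ζ h η‖) ^ (2 * ((m : ℝ) / 2)) = xWeight ζ h m η ^ 2 := by
  rw [xWeight_sq ζ hh, mul_div_cancel₀ _ two_ne_zero, Real.rpow_natCast]

theorem rpow_eq_inv_xWeight_sq {d : ℕ} (ζ : Fin d → ℂ) {h : ℝ} (hh : 0 < h) (m : ℕ) (η : Eu d) :
    (h + ‖scaledSymbol ζ h η‖) ^ (2 * (-(m : ℝ) / 2)) = ((xWeight ζ h m η)⁻¹) ^ 2 := by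
  rw [inv_pow, xWeight_sq ζ hh, mul_div_cancel₀ _ two_ne_zero, Real.rpow_neg (by positivity),
    Real.rpow_natCast]

theorem HasHat.xNorm_le {d : ℕ} {u : TD d} {g : Eu d → ℂ} (hu : HasHat u g) (ζ : Fin d → ℂ) {h : ℝ}
    (hh : 0 < h) (m : ℕ) : xNorm ζ h ((m : ℝ) / 2) u ≤
      jacobian d ^ (1 / 2 : ℝ) * eLpNorm (fun η => (xWeight ζ h m η : ℂ) * g η) 2 volume := by
  refine (iInf₂_le g hu.isFunction).trans (le_of_eq ?_)
  exact xNorm_integrand_eq ζ h _ (fun η => pow_nonneg (Real.sqrt_nonneg _) _)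
    (rpow_eq_xWeight_sq ζ hh m) g

/-- A tempered distribution whose Fourier transform is a function `g` is given by integration
against `g` on the Fourier side for all Schwartz functions, if `g` has a square integrable quotient
by a weight. -/
theorem IsFunction.apply_eq {d : ℕ} {f : TD d} {g : Eu d → ℂ} (hg : IsFunction (𝓕 f) g)
    {ω : Eu d → ℝ} (hω : IsWeight ω) (hg2 : MemLp (fun η => ((ω η)⁻¹ : ℝ) * g η) 2 volume)
    (v : 𝓢(Eu d, ℂ)) : f v = ∫ η, 𝓕⁻ v η * g η := by
  obtain ⟨C, N, hC⟩ := hω.exists_ge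
  have hmem : MemLp (fun η => ((besselWeight N η)⁻¹ : ℝ) * g η) 2 volume := by
    refine hg2.of_le_mul (c := C) ?_ (Eventually.of_forall fun η => ?_)
    · have : Continuous fun η : Eu d => (((besselWeight N η)⁻¹ : ℝ) : ℂ) :=
        Complex.continuous_ofReal.comp
          ((continuous_besselWeight N).inv₀ fun η => (besselWeight_pos N η).ne')
      exact this.aestronglyMeasurable.mul hg.1.aestronglyMeasurable
    · have h1 := hω.pos η
      have h2 := besselWeight_pos N η
      rw [norm_mul, norm_mul, Complex.norm_real, Complex.norm_real,
        Real.norm_of_nonneg (inv_nonneg.2 h1.le), Real.norm_of_nonneg (inv_nonneg.2 h2.le),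
        ← mul_assoc]
      refine mul_le_mul_of_nonneg_right ?_ (norm_nonneg _)
      rw [← div_eq_mul_inv, inv_eq_one_div, div_le_div_iff₀ h2 h1, one_mul]
      exact hC η
  obtain ⟨u, hu⟩ := exists_hasHat hmem
  set T := TemperedDistribution.besselPotential (Eu d) ℂ (N : ℝ) u with hT
  have hTv : ∀ v, T v = ∫ η, 𝓕⁻ v η * g η := fun v => by
    rw [hT, hu.bessel_apply N v]
    congr 1 with η
    have := (besselWeight_pos N η).ne'
    rw [Complex.ofReal_inv, mul_inv_cancel_left₀ (Complex.ofReal_ne_zero.2 this)]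
  have heq : 𝓕 f = 𝓕 T := eq_of_forall_hasCompactSupport fun w hw => by
    rw [hg.2 w hw, TemperedDistribution.fourier_apply T, hTv]
    simp
  have h1 := TemperedDistribution.fourier_apply f (𝓕⁻ v)
  rw [heq, TemperedDistribution.fourier_apply T, FourierTransform.fourier_fourierInv_eq] at h1
  rw [← h1, hTv]

/-- The elements of `X^{-m/2}` on the Fourier side. -/
theorem MemX.exists_fourier {d : ℕ} {ζ : Fin d → ℂ} (hζ : ζ ∈ zetaSet d) {h : ℝ} (hh : 0 < h)
    {m : ℕ} {f : TD d} (hf : MemX ζ h (-(m : ℝ) / 2) f) :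
    ∃ g : Eu d → ℂ, MemLp (fun η => ((xWeight ζ h m η)⁻¹ : ℝ) * g η) 2 volume ∧
      (∀ v : 𝓢(Eu d, ℂ), f v = ∫ η, 𝓕⁻ v η * g η) ∧
      jacobian d ^ (1 / 2 : ℝ) * eLpNorm (fun η => ((xWeight ζ h m η)⁻¹ : ℝ) * g η) 2 volume
        = xNorm ζ h (-(m : ℝ) / 2) f := by
  have hω := isWeight_xWeight hζ hh m
  have hint : ∀ g : Eu d → ℂ, _ := xNorm_integrand_eq ζ h (-(m : ℝ) / 2)
    (fun η => inv_nonneg.2 (hω.pos η).le) (rpow_eq_inv_xWeight_sq ζ hh m)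
  have hf' := hf
  simp only [MemX, xNorm, hint, iInf_lt_iff] at hf'
  obtain ⟨g, hg, hlt⟩ := hf'
  have hj : jacobian d ^ (1 / 2 : ℝ) ≠ 0 := by
    have : jacobian d ≠ 0 := by
      rw [jacobian, ne_eq, ENNReal.ofReal_eq_zero, not_le]
      positivity
    simpa [ENNReal.rpow_eq_zero_iff] using this
  have hmem : MemLp (fun η => (((xWeight ζ h m η)⁻¹ : ℝ) : ℂ) * g η) 2 volume := by
    refine ⟨?_, lt_top_iff_ne_top.2 fun htop => ?_⟩
    · have : Continuous fun η : Eu d => (((xWeight ζ h m η)⁻¹ : ℝ) : ℂ) :=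
        Complex.continuous_ofReal.comp (hω.continuous.inv₀ fun η => (hω.pos η).ne')
      exact this.aestronglyMeasurable.mul hg.1.aestronglyMeasurable
    · rw [htop, ENNReal.mul_top hj] at hlt
      exact lt_irrefl _ hlt
  refine ⟨g, hmem, hg.apply_eq hω hmem, le_antisymm ?_ ?_⟩
  · simp only [xNorm, hint]
    refine le_iInf₂ fun g' hg' => le_of_eq ?_
    congr 1
    refine eLpNorm_congr_ae ?_
    filter_upwards [hg.ae_eq hg'] with η hη
    rw [hη]
  · simp only [xNorm, hint]
    exact iInf₂_le g hg

end Polyharmonic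

namespace Polyharmonic

/-! ### Weak solutions by duality -/

/-- Integration against a square integrable function is a continuous functional on `L²`. -/
theorem exists_clm_integral_mul {d : ℕ} {k : Eu d → ℂ} (hk : MemLp k 2 volume) :
    ∃ L : Lp ℂ 2 (volume : Measure (Eu d)) →L[ℂ] ℂ, ‖L‖ ≤ ‖hk.toLp k‖ ∧
      ∀ (f : Lp ℂ 2 (volume : Measure (Eu d))) (g : Eu d → ℂ), f =ᵐ[volume] g →
        L f = ∫ η, g η * k η := by
  refine ⟨innerSL ℂ (hk.star.toLp (star k)), ?_, fun f g hfg => ?_⟩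
  · rw [innerSL_apply_norm, Lp.norm_toLp, Lp.norm_toLp]
    refine le_of_eq (congrArg _ (eLpNorm_congr_norm_ae (Eventually.of_forall fun x => by simp)))
  · rw [innerSL_apply_apply, L2.inner_def]
    refine integral_congr_ae ?_
    filter_upwards [hfg, hk.star.coeFn_toLp] with η h1 h2
    rw [h1, h2]
    simp

theorem HasHat.apply_iterate_transP {d : ℕ} {u : TD d} {g : Eu d → ℂ} (hu : HasHat u g)
    {ζ : Fin d → ℂ} (hζ : ζ ∈ zetaSet d) {h : ℝ} (hh : 0 < h) (m : ℕ) (v : 𝓢(Eu d, ℂ)) :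
    u ((transP ζ h)^[m] v) = ∫ η, (xWeight ζ h m η : ℂ) * g η * mainPart ζ h m v η := by
  rw [hu.2]
  congr 1 with η
  have h0 : (xWeight ζ h m η : ℂ) ≠ 0 :=
    Complex.ofReal_ne_zero.2 ((isWeight_xWeight hζ hh m).pos η).ne'
  rw [fourierInv_iterate_transP, mainPart, Complex.ofReal_inv]
  field_simp

/-- The bilinear form `(v, φ) ↦ ⟨L_ζ φ, v⟩`. -/
noncomputable def fullForm {d : ℕ} (m : ℕ) (Q : Fin d → TD d) (q : TD d) (ζ : Fin d → ℂ) (h : ℝ) :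
    𝓢(Eu d, ℂ) →ₗ[ℂ] 𝓢(Eu d, ℂ) →ₗ[ℂ] ℂ :=
  LinearMap.mk₂ ℂ (fun v (φ : 𝓢(Eu d, ℂ)) => (φ : TD d) ((transP ζ h ^ m) v))
    (fun v v' φ => by rw [map_add, map_add])
    (fun c v φ => by rw [map_smul, map_smul])
    (fun v φ φ' => by
      rw [map_add]
      rfl)
    (fun c v φ => by
      rw [map_smul]
      rfl)
    + pertForm m Q q ζ h

theorem fullForm_apply {d : ℕ} (m : ℕ) (Q : Fin d → TD d) (q : TD d) (ζ : Fin d → ℂ) (h : ℝ)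
    (v φ : 𝓢(Eu d, ℂ)) : fullForm m Q q ζ h v φ =
      (φ : TD d) ((transP ζ h)^[m] v) + pertForm m Q q ζ h v φ := by
  rw [← Module.End.pow_apply]
  rfl

/-- The duality argument: the a priori estimate for the transpose on functions supported in `Ω`,
together with the smallness of the lower order terms, yields `G = ω 𝓕ψ` for a weak solution
`ψ` of `L_ζ ψ = f`. -/
theorem exists_weak_solution {d m : ℕ} {Q : Fin d → TD d} {q : TD d} {ζ : Fin d → ℂ}
    (hζ : ζ ∈ zetaSet d) {h : ℝ} (hh : 0 < h) (V : Submodule ℂ 𝓢(Eu d, ℂ)) {c : ℝ} (hc : 0 < c)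
    (hV : ∀ v ∈ V, c * ‖weightFourierInv (isWeight_xWeight hζ hh m) v‖
      ≤ ‖(memLp_mainPart hζ hh m v).toLp _‖)
    (hpert : ∀ v φ, ‖pertForm m Q q ζ h v φ‖ ≤ c / 2 *
      (‖weightFourier (isWeight_xWeight hζ hh m) φ‖ *
        ‖weightFourierInv (isWeight_xWeight hζ hh m) v‖))
    {f : TD d} {g : Eu d → ℂ} (hg : MemLp (fun η => ((xWeight ζ h m η)⁻¹ : ℝ) * g η) 2 volume)
    (hfg : ∀ v : 𝓢(Eu d, ℂ), f v = ∫ η, 𝓕⁻ v η * g η) :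
    ∃ G : Lp ℂ 2 (volume : Measure (Eu d)), ‖G‖ ≤ 2 / c * ‖hg.toLp _‖ ∧
      ∀ v ∈ V, ∀ φ : ℕ → 𝓢(Eu d, ℂ),
        Tendsto (fun n => weightFourier (isWeight_xWeight hζ hh m) (φ n)) atTop (𝓝 G) →
        Tendsto (fun n => fullForm m Q q ζ h v (φ n)) atTop (𝓝 (f v)) := by
  have hω := isWeight_xWeight hζ hh m
  have hmain : ∀ v φ : 𝓢(Eu d, ℂ), (φ : TD d) ((transP ζ h)^[m] v)
      = ∫ η, (xWeight ζ h m η : ℂ) * 𝓕 φ η * mainPart ζ h m v η := fun v φ =>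
    (hasHat_schwartz φ).apply_iterate_transP hζ hh m v
  have hmain_le : ∀ v φ : 𝓢(Eu d, ℂ), ‖(φ : TD d) ((transP ζ h)^[m] v)‖ ≤
      ‖(memLp_mainPart hζ hh m v).toLp _‖ * ‖weightFourier hω φ‖ := fun v φ => by
    obtain ⟨L, hL, hL'⟩ := exists_clm_integral_mul (memLp_mainPart hζ hh m v)
    rw [hmain, ← hL' _ _ (coeFn_weightMul hω (𝓕 φ))]
    exact L.le_of_opNorm_le hL _
  have hf_le : ∀ v, ‖f v‖ ≤ ‖hg.toLp _‖ * ‖weightFourierInv hω v‖ := fun v => by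
    obtain ⟨L, hL, hL'⟩ := exists_clm_integral_mul hg
    refine le_trans (le_of_eq ?_) (L.le_of_opNorm_le hL (weightFourierInv hω v))
    rw [hfg, weightFourierInv_apply, hL' _ _ (coeFn_weightMul hω (𝓕⁻ v))]
    congr 2 with η
    have h0 : (xWeight ζ h m η : ℂ) ≠ 0 := Complex.ofReal_ne_zero.2 (hω.pos η).ne'
    rw [Complex.ofReal_inv]
    field_simp
  have hA : ∀ v : V, ∃ C, ∀ φ, ‖(fullForm m Q q ζ h).domRestrict V v φ‖ ≤
      C * ‖weightFourier hω φ‖ := fun v => by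
    refine ⟨‖(memLp_mainPart hζ hh m v).toLp _‖ + c / 2 * ‖weightFourierInv hω v‖, fun φ => ?_⟩
    rw [LinearMap.domRestrict_apply, fullForm_apply]
    refine (norm_add_le _ _).trans ((add_le_add (hmain_le v φ) (hpert v φ)).trans (le_of_eq ?_))
    ring
  have hΛ : ∀ (v : V) (C : ℝ), 0 ≤ C →
      (∀ φ, ‖(fullForm m Q q ζ h).domRestrict V v φ‖ ≤ C * ‖weightFourier hω φ‖) →
      ‖f.toLinearMap.domRestrict V v‖ ≤ 2 / c * ‖hg.toLp _‖ * C := fun v C hC hv => by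
    set N := ‖weightFourierInv hω v‖ with hN
    -- the main part of the form is bounded by the full form and the lower order terms
    have h1 : ‖(memLp_mainPart hζ hh m v).toLp _‖ ≤ C + c / 2 * N := by
      refine norm_le_of_forall_weightMul hω (memLp_mainPart hζ hh m v) (by positivity) fun φ => ?_
      have h2 := hmain v (𝓕⁻ φ)
      have h3 := hv (𝓕⁻ φ)
      have h4 := hpert v (𝓕⁻ φ)
      rw [LinearMap.domRestrict_apply, fullForm_apply] at h3
      rw [weightFourier_apply] at h3 h4
      rw [FourierTransform.fourier_fourierInv_eq] at h2 h3 h4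
      rw [← h2]
      have h5 := norm_sub_le
        (((𝓕⁻ φ : 𝓢(Eu d, ℂ)) : TD d) ((transP ζ h)^[m] v) + pertForm m Q q ζ h v (𝓕⁻ φ))
        (pertForm m Q q ζ h v (𝓕⁻ φ))
      rw [add_sub_cancel_right] at h5
      refine h5.trans ((add_le_add h3 h4).trans (le_of_eq ?_))
      rw [← hN]
      ring
    have h2 : N ≤ 2 / c * C := by
      have h3 := hV v v.2
      rw [div_mul_eq_mul_div, le_div_iff₀ hc]
      linarith
    calc ‖f v‖ ≤ ‖hg.toLp _‖ * N := hf_le v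
      _ ≤ ‖hg.toLp _‖ * (2 / c * C) := by gcongr
      _ = _ := by ring
  obtain ⟨G, hG, hlim⟩ := exists_tendsto_of_bilinear (weightFourier hω)
    (denseRange_weightFourier hω) ((fullForm m Q q ζ h).domRestrict V) hA
    (f.toLinearMap.domRestrict V) (by positivity) hΛ
  exact ⟨G, hG, fun v hv φ hφ => hlim ⟨v, hv⟩ φ hφ⟩

/-! ### Regularity of the weak solution -/

/-- For fixed `h`, the space `X^{m/2}` embeds into `W^{m,2}`. -/
theorem exists_besselWeight_le {d : ℕ} {ζ : Fin d → ℂ} (hζ : ζ ∈ zetaSet d) {h : ℝ} (hh : 0 < h)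
    (hh1 : h ≤ 1) (m : ℕ) : ∃ C, 0 ≤ C ∧ ∀ η : Eu d, besselWeight m η ≤ C * xWeight ζ h m η := by
  refine ⟨2 ^ (m - 1) * (8 ^ m * (√h ^ m)⁻¹ + 8 ^ m * (√h ^ m)⁻¹ * h⁻¹ ^ m), by positivity,
    fun η => ?_⟩
  have h0 := pow_le_xWeight hζ hh hh1 (Nat.zero_le m) η
  have h1 := pow_le_xWeight hζ hh hh1 (le_refl m) η
  rw [pow_zero, pow_zero, mul_one] at h0
  have h2 : ‖η‖ ^ m ≤ (2 * Real.pi * ‖η‖) ^ m := by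
    gcongr
    have := Real.pi_gt_three
    nlinarith [norm_nonneg η]
  have h3 : √(1 + ‖η‖ ^ 2) ≤ 1 + ‖η‖ := by
    rw [Real.sqrt_le_left (by positivity)]
    nlinarith [norm_nonneg η]
  calc besselWeight m η ≤ (1 + ‖η‖) ^ m := by
        rw [besselWeight_eq]
        gcongr
    _ ≤ 2 ^ (m - 1) * (1 ^ m + ‖η‖ ^ m) := add_pow_le zero_le_one (norm_nonneg η) m
    _ ≤ 2 ^ (m - 1) * (8 ^ m * (√h ^ m)⁻¹ * xWeight ζ h m η
        + 8 ^ m * (√h ^ m)⁻¹ * h⁻¹ ^ m * xWeight ζ h m η) := by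
        rw [one_pow]
        gcongr
        exact h2.trans h1
    _ = _ := by ring

/-- The symbol of `ζ_j / (ih) + D_j` has order one. -/
theorem exists_shift_le {d : ℕ} (k : ℕ) (b : ℂ) (j : Fin d) : ∃ C, 0 ≤ C ∧ ∀ η : Eu d,
    besselWeight k η * ‖b + 2 * Real.pi * (η j : ℂ)‖ ≤ C * besselWeight (k + 1) η := by
  refine ⟨‖b‖ + 2 * Real.pi, by positivity, fun η => ?_⟩
  have h1 : 1 ≤ √(1 + ‖η‖ ^ 2) := Real.one_le_sqrt.2 (by nlinarith [norm_nonneg η])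
  have h2 : ‖η‖ ≤ √(1 + ‖η‖ ^ 2) := Real.le_sqrt_of_sq_le (by linarith)
  have h3 : ‖b + 2 * Real.pi * (η j : ℂ)‖ ≤ (‖b‖ + 2 * Real.pi) * √(1 + ‖η‖ ^ 2) := by
    refine (norm_add_le _ _).trans ?_
    have h4 : ‖(2 * Real.pi * (η j : ℂ) : ℂ)‖ = 2 * Real.pi * |η j| := by
      rw [norm_mul, norm_mul, Complex.norm_real, Complex.norm_real,
        Real.norm_of_nonneg Real.pi_pos.le, Complex.norm_two, Real.norm_eq_abs]
    rw [h4, add_mul]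
    have h5 := abs_apply_le_norm η j
    have h6 : |η j| ≤ √(1 + ‖η‖ ^ 2) := h5.trans h2
    have := le_mul_of_one_le_right (norm_nonneg b) h1
    have := mul_le_mul_of_nonneg_left h6 Real.two_pi_pos.le
    linarith
  rw [besselWeight_eq, besselWeight_eq, pow_succ _ k]
  calc _ ≤ √(1 + ‖η‖ ^ 2) ^ k * ((‖b‖ + 2 * Real.pi) * √(1 + ‖η‖ ^ 2)) :=
        mul_le_mul_of_nonneg_left h3 (by positivity)
    _ = _ := by ring

section Multiplier

variable {d : ℕ} {ω : Eu d → ℝ} {g : Eu d → ℂ} {G : Lp ℂ 2 (volume : Measure (Eu d))}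

theorem memLp_mul_of_norm_le (hω : IsWeight ω) (hg : AEStronglyMeasurable g)
    (hgG : ∀ᵐ η, (ω η : ℂ) * g η = G η) {b : Eu d → ℂ} (hb : Continuous b) {C : ℝ}
    (hC : ∀ η, ‖b η‖ ≤ C * ω η) : MemLp (fun η => b η * g η) 2 volume := by
  refine (Lp.memLp G).of_le_mul (c := C) (hb.aestronglyMeasurable.mul hg) ?_
  filter_upwards [hgG] with η hη
  rw [← hη, norm_mul, norm_mul, Complex.norm_real, Real.norm_of_nonneg (hω.pos η).le, ← mul_assoc]
  exact mul_le_mul_of_nonneg_right (hC η) (norm_nonneg _)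

/-- Convergence in the norm of `X^{m/2}` implies convergence in Sobolev norms, also after applying
a Fourier multiplier `S` with symbol `a`. -/
theorem tendsto_sobolevENorm_sub (hω : IsWeight ω) (hgG : ∀ᵐ η, (ω η : ℂ) * g η = G η) {k : ℕ}
    {S : 𝓢(Eu d, ℂ) → 𝓢(Eu d, ℂ)} {a : Eu d → ℂ} (hS : ∀ φ η, 𝓕 (S φ) η = a η * 𝓕 φ η) {C : ℝ}
    (hC : ∀ η, besselWeight k η * ‖a η‖ ≤ C * ω η)
    {u : TD d} (hu : HasHat u fun η => a η * g η)
    (hmem : MemLp (fun η => (besselWeight k η : ℂ) * (a η * g η)) 2 volume)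
    {φ : ℕ → 𝓢(Eu d, ℂ)} (hφ : Tendsto (fun n => weightFourier hω (φ n)) atTop (𝓝 G)) :
    Tendsto (fun n => sobolevENorm k ((S (φ n) : TD d) - u)) atTop (𝓝 0) := by
  have hle : ∀ ψ, ‖weightFourier (isWeight_besselWeight k) (S ψ) - hmem.toLp _‖ ≤
      C * ‖weightFourier hω ψ - G‖ := fun ψ => by
    refine Lp.norm_le_mul_norm_of_ae_le_mul ?_
    filter_upwards [hgG, Lp.coeFn_sub (weightFourier (isWeight_besselWeight k) (S ψ)) (hmem.toLp _),
      Lp.coeFn_sub (weightFourier hω ψ) G, coeFn_weightMul (isWeight_besselWeight k) (𝓕 (S ψ)),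
      coeFn_weightMul hω (𝓕 ψ), hmem.coeFn_toLp] with η h1 h2 h3 h4 h5 h6
    rw [h2, h3, Pi.sub_apply, Pi.sub_apply, weightFourier_apply, weightFourier_apply, h4, h5, h6,
      ← h1, hS, ← mul_sub, ← mul_sub, ← mul_sub, norm_mul, norm_mul, norm_mul, Complex.norm_real,
      Complex.norm_real, Real.norm_of_nonneg (hω.pos η).le,
      Real.norm_of_nonneg (besselWeight_pos k η).le, ← mul_assoc, ← mul_assoc]
    exact mul_le_mul_of_nonneg_right (hC η) (norm_nonneg _)
  have h0 : Tendsto (fun n => weightFourier (isWeight_besselWeight k) (S (φ n)) - hmem.toLp _)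
      atTop (𝓝 0) := by
    refine squeeze_zero_norm (fun n => hle (φ n)) ?_
    have := (tendsto_iff_norm_sub_tendsto_zero.1 hφ).const_mul C
    rwa [mul_zero] at this
  have h1 := (continuous_enorm.tendsto _).comp h0
  rw [enorm_zero] at h1
  refine h1.congr fun n => ?_
  rw [Function.comp_apply, hu.sobolevENorm_sub_eq hmem]

end Multiplier

end Polyharmonic

namespace Polyharmonic

theorem tendsto_apply {d : ℕ} {T : ℕ → TD d} {S : TD d} (hT : Tendsto T atTop (𝓝 S))
    (v : 𝓢(Eu d, ℂ)) : Tendsto (fun n => T n v) atTop (𝓝 (S v)) :=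
  ((PointwiseConvergenceCLM.evalCLM (RingHom.id ℂ) ℂ v).continuous.tendsto S).comp hT

/-- A weak solution, given by `G = ω 𝓕ψ`, is a solution in the sense of distributions. -/
theorem exists_isSolution {d k : ℕ} {θ M : ℝ≥0} (hθ : 0 < θ)
    {Qp : Fin d → (Fin d → ℕ) → Eu d → ℂ} {qp : (Fin d → ℕ) → Eu d → ℂ}
    {Q : Fin d → TD d} {q : TD d}
    (hQp : ∀ j, ∀ β ∈ multiIndices d k, holderENorm θ (Qp j β) ≤ M)
    (hqp : ∀ β ∈ multiIndices d (k + 1), holderENorm θ (qp β) ≤ M)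
    (hQ : ∀ j, Q j = ∑ β ∈ multiIndices d k, Dpow β (ofBounded (Qp j β)))
    (hq : q = ∑ β ∈ multiIndices d (k + 1), Dpow β (ofBounded (qp β)))
    {ζ : Fin d → ℂ} (hζ : ζ ∈ zetaSet d) {h : ℝ} (hh : 0 < h) (hh1 : h ≤ 1) {Ω : Set (Eu d)}
    {f : TD d} {G : Lp ℂ 2 (volume : Measure (Eu d))}
    (hG : ∀ v : 𝓢(Eu d, ℂ), tsupport v ⊆ Ω → ∀ φ : ℕ → 𝓢(Eu d, ℂ),
      Tendsto (fun n => weightFourier (isWeight_xWeight hζ hh (k + 1)) (φ n)) atTop (𝓝 G) →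
      Tendsto (fun n => fullForm (k + 1) Q q ζ h v (φ n)) atTop (𝓝 (f v))) :
    ∃ ψ : TD d, HasHat ψ (fun η => ((xWeight ζ h (k + 1) η)⁻¹ : ℝ) * G η) ∧
      IsSolution Ω (k + 1) Q q ζ h f ψ := by
  have hω := isWeight_xWeight hζ hh (k + 1)
  set g : Eu d → ℂ := fun η => ((xWeight ζ h (k + 1) η)⁻¹ : ℝ) * G η with hgdef
  have hωG : ∀ η, (xWeight ζ h (k + 1) η : ℂ) * g η = G η := fun η => by
    simp only [hgdef]
    rw [Complex.ofReal_inv,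
      mul_inv_cancel_left₀ (Complex.ofReal_ne_zero.2 (hω.pos η).ne')]
  have hgG : ∀ᵐ η, (xWeight ζ h (k + 1) η : ℂ) * g η = G η := Eventually.of_forall hωG
  have hgm : AEStronglyMeasurable g := by
    have : Continuous fun η : Eu d => (((xWeight ζ h (k + 1) η)⁻¹ : ℝ) : ℂ) :=
      Complex.continuous_ofReal.comp (hω.continuous.inv₀ fun η => (hω.pos η).ne')
    exact this.aestronglyMeasurable.mul (Lp.aestronglyMeasurable G)
  obtain ⟨C, hC0, hC⟩ := exists_besselWeight_le hζ hh hh1 (k + 1)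
  -- the symbol of `ζ_j / (ih) + D_j`
  set a : Fin d → Eu d → ℂ := fun j η => ζ j / (Complex.I * (h : ℂ)) + 2 * Real.pi * (η j : ℂ)
    with ha
  have hac : ∀ j, Continuous (a j) := fun j => by
    rw [ha]
    fun_prop
  have hbc : ∀ n : ℕ, Continuous fun η : Eu d => (besselWeight n η : ℂ) := fun n =>
    Complex.continuous_ofReal.comp (continuous_besselWeight n)
  have ha_le : ∀ (b : ℂ) (j : Fin d), ∃ C', ∀ η : Eu d,
      besselWeight k η * ‖b + 2 * Real.pi * (η j : ℂ)‖ ≤ C' * xWeight ζ h (k + 1) η :=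
    fun b j => by
      obtain ⟨C', hC0', hC'⟩ := exists_shift_le (d := d) k b j
      refine ⟨C' * C, fun η => (hC' η).trans ?_⟩
      rw [mul_assoc]
      exact mul_le_mul_of_nonneg_left (hC η) hC0'
  have hmem : MemLp (fun η => (besselWeight (k + 1) η : ℂ) * g η) 2 volume :=
    memLp_mul_of_norm_le hω hgm hgG (hbc _) (C := C) fun η => by
      rw [Complex.norm_real, Real.norm_of_nonneg (besselWeight_pos _ _).le]
      exact hC η
  have hmema : ∀ j, MemLp (fun η => (besselWeight k η : ℂ) * (a j η * g η)) 2 volume := fun j => by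
    obtain ⟨C', hC'⟩ := ha_le (ζ j / (Complex.I * (h : ℂ))) j
    have := memLp_mul_of_norm_le hω hgm hgG ((hbc k).mul (hac j)) (C := C') fun η => by
      rw [Pi.mul_apply, norm_mul, Complex.norm_real, Real.norm_of_nonneg (besselWeight_pos _ _).le]
      exact hC' η
    refine (memLp_congr_ae (Eventually.of_forall fun η => ?_)).1 this
    exact mul_assoc _ _ _
  have hmemη : ∀ j, MemLp (fun η => (2 * Real.pi * η j : ℂ) * g η) 2 volume := fun j => by
    obtain ⟨C', hC'⟩ := ha_le 0 j
    refine memLp_mul_of_norm_le hω hgm hgG (by fun_prop) (C := C') fun η => ?_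
    refine le_trans ?_ (hC' η)
    rw [zero_add]
    exact le_mul_of_one_le_left (norm_nonneg _) (one_le_besselWeight k η)
  have hmem0 : MemLp g 2 volume := by
    obtain ⟨c, hc, hc'⟩ := hω.exists_le
    have := memLp_mul_of_norm_le hω hgm hgG (b := fun _ => 1) continuous_const (C := c⁻¹)
      fun η => by
        rw [norm_one, ← div_eq_inv_mul, le_div_iff₀ hc, one_mul]
        exact hc' η
    simpa using this
  obtain ⟨ψ, hψ⟩ := exists_hasHat hmem0
  have hψa : ∀ j, HasHat ((ζ j / (Complex.I * (h : ℂ))) • ψ + D j ψ) (fun η => a j η * g η) :=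
    fun j => ((hψ.smul (ζ j / (Complex.I * (h : ℂ)))).add (hψ.D j (hmemη j))).congr_ae
      (Eventually.of_forall fun η => (add_mul _ _ _).symm)
  have hR : ∀ j, ∃ R, IsProduct k (Q j) ((ζ j / (Complex.I * (h : ℂ))) • ψ + D j ψ) R := fun j =>
    exists_isProduct (hψa j) (hmema j) fun φ v => by
      rw [hQ]
      exact norm_sum_Dpow_mul_le hθ (hQp j) φ v
  choose R hR using hR
  obtain ⟨r, hr⟩ : ∃ r, IsProduct (k + 1) q ψ r :=
    exists_isProduct hψ hmem fun φ v => by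
      rw [hq]
      exact norm_sum_Dpow_mul_le hθ hqp φ v
  refine ⟨ψ, hψ, hψ.memSobolev hmem, R, r, hR, hr, fun v _ hv => ?_⟩
  obtain ⟨φ, hφ⟩ := exists_tendsto_weightFourier hω G
  refine tendsto_nhds_unique ?_ (hG v hv φ hφ)
  have hlimR : ∀ j, Tendsto (fun n => Q j (SchwartzMap.smulLeftCLM ℂ (shiftD ζ h j (φ n)) v)) atTop
      (𝓝 (R j v)) := fun j => by
    obtain ⟨C', hC'⟩ := ha_le (ζ j / (Complex.I * (h : ℂ))) j
    exact tendsto_apply ((hR j).1 _ (tendsto_sobolevENorm_sub hω hgG (fourier_shiftD ζ h j) hC'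
      (hψa j) (hmema j) hφ)) v
  have hlimr : Tendsto (fun n => q (SchwartzMap.smulLeftCLM ℂ (φ n) v)) atTop (𝓝 (r v)) := by
    refine tendsto_apply (hr.1 _ (tendsto_sobolevENorm_sub hω hgG (S := id) (a := fun _ => 1)
      (fun _ _ => (one_mul _).symm) (C := C) (fun η => ?_) ?_ ?_ hφ)) v
    · rw [norm_one, mul_one]
      exact hC η
    · simpa using hψ
    · simpa using hmem
  have hlimP : Tendsto (fun n => (φ n : TD d) ((transP ζ h)^[k + 1] v)) atTop
      (𝓝 (((opP ζ h)^[k + 1] ψ) v)) := by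
    obtain ⟨L, -, hL⟩ := exists_clm_integral_mul (memLp_mainPart hζ hh (k + 1) v)
    rw [iterate_opP_apply, hψ.apply_iterate_transP hζ hh, ← hL G _ (hgG.mono fun η hη => hη.symm)]
    refine ((L.continuous.tendsto G).comp hφ).congr fun n => ?_
    rw [(hasHat_schwartz (φ n)).apply_iterate_transP hζ hh,
      ← hL _ _ (coeFn_weightMul hω (𝓕 (φ n)))]
    rfl
  have hval : ((opP ζ h)^[k + 1] ψ + ((h : ℂ) ^ (2 * (k + 1))) • ∑ j, R j
      + ((h : ℂ) ^ (2 * (k + 1))) • r) v = ((opP ζ h)^[k + 1] ψ) v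
      + ((h : ℂ) ^ (2 * (k + 1)) * ∑ j, R j v + (h : ℂ) ^ (2 * (k + 1)) * r v) := by
    rw [← sum_TD_apply, ← add_assoc]
    rfl
  rw [hval]
  simp only [fullForm_apply, pertForm_apply]
  exact hlimP.add (((tendsto_finsetSum _ fun j _ => hlimR j).const_mul _).add
    (hlimr.const_mul _))

/-- The Schwartz functions that vanish outside of `Ω`. -/
def vanishingOutside {d : ℕ} (Ω : Set (Eu d)) : Submodule ℂ 𝓢(Eu d, ℂ) where
  carrier := {v | ∀ x ∉ Ω, v x = 0}
  add_mem' {v w} hv hw x hx := by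
    change v x + w x = 0
    rw [hv x hx, hw x hx, add_zero]
  zero_mem' _ _ := rfl
  smul_mem' c v hv x hx := by
    change c • v x = 0
    rw [hv x hx, smul_zero]

theorem exists_sqrt_rpow_le {θ : ℝ≥0} (hθ : 0 < θ) {ε : ℝ} (hε : 0 < ε) :
    ∃ h₀ : ℝ, 0 < h₀ ∧ h₀ < 1 ∧ ∀ h, 0 < h → h ≤ h₀ → √h ^ (θ : ℝ) ≤ ε := by
  have hcont : Tendsto (fun h : ℝ => √h ^ (θ : ℝ)) (𝓝 0) (𝓝 0) := by
    have : Continuous fun h : ℝ => √h ^ (θ : ℝ) :=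
      Real.continuous_sqrt.rpow_const fun h => Or.inr θ.2
    have h0 := this.tendsto 0
    rwa [Real.sqrt_zero, Real.zero_rpow (NNReal.coe_ne_zero.2 hθ.ne')] at h0
  obtain ⟨δ, hδ, hδ'⟩ := Metric.eventually_nhds_iff.1 (hcont.eventually_lt_const hε)
  refine ⟨min (δ / 2) (1 / 2), by positivity, (min_le_right _ _).trans_lt (by norm_num),
    fun h hh hh' => (hδ' ?_).le⟩
  rw [Real.dist_eq, sub_zero, abs_of_pos hh]
  linarith [min_le_left (δ / 2) (1 / 2)]

end Polyharmonic

theorem mainTheorem6 (d m : ℕ) (hd : 3 ≤ d) (hm : 2 ≤ m)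
    (Ω : Set (Polyharmonic.Eu d)) (hΩo : IsOpen Ω) (hΩb : Bornology.IsBounded Ω)
    (θ : ℝ≥0) (hθ0 : 0 < θ) (hθ1 : θ ≤ 1) (M : ℝ≥0) :
    ∃ h₀ : ℝ, 0 < h₀ ∧ h₀ < 1 ∧ ∃ C : ℝ≥0,
      ∀ (Qp : Fin d → (Fin d → ℕ) → Polyharmonic.Eu d → ℂ)
        (qp : (Fin d → ℕ) → Polyharmonic.Eu d → ℂ)
        (Q : Fin d → Polyharmonic.TD d) (q : Polyharmonic.TD d),
        (∀ j, ∀ β ∈ Polyharmonic.multiIndices d (m - 1),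
          Polyharmonic.holderENorm θ (Qp j β) ≤ M ∧ tsupport (Qp j β) ⊆ closure Ω) →
        (∀ β ∈ Polyharmonic.multiIndices d m,
          Polyharmonic.holderENorm θ (qp β) ≤ M ∧ tsupport (qp β) ⊆ closure Ω) →
        (∀ j, Q j = ∑ β ∈ Polyharmonic.multiIndices d (m - 1),
          Polyharmonic.Dpow β (Polyharmonic.ofBounded (Qp j β))) →
        (q = ∑ β ∈ Polyharmonic.multiIndices d m,
          Polyharmonic.Dpow β (Polyharmonic.ofBounded (qp β))) →
        ∀ ζ ∈ Polyharmonic.zetaSet d, ∀ h : ℝ, 0 < h → h ≤ h₀ →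
          ∀ f : Polyharmonic.TD d, Polyharmonic.MemX ζ h (-(m : ℝ) / 2) f →
            ∃ ψ : Polyharmonic.TD d,
              Polyharmonic.MemX ζ h ((m : ℝ) / 2) ψ ∧
              Polyharmonic.IsSolution Ω m Q q ζ h f ψ ∧
              Polyharmonic.xNorm ζ h ((m : ℝ) / 2) ψ
                ≤ C * Polyharmonic.xNorm ζ h (-(m : ℝ) / 2) f := by
  obtain ⟨k, rfl⟩ : ∃ k, m = k + 1 := ⟨m - 1, by omega⟩
  have hk : 1 ≤ k := by omega
  obtain ⟨R, hR, hΩR⟩ := hΩb.exists_pos_norm_le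
  obtain ⟨c, hc, hap⟩ := Polyharmonic.exists_apriori (d := d) hm hR
  -- the constant in the bound of the lower order terms by `√h ^ θ`
  set B : ℝ := (3 * d * (Polyharmonic.multiIndices d k).card
    + (Polyharmonic.multiIndices d (k + 1)).card) * (2 * M) * 128 ^ (k + 1) with hB
  have hB0 : 0 ≤ B := by positivity
  obtain ⟨h₀, hh0, hh1, hsmall⟩ :=
    Polyharmonic.exists_sqrt_rpow_le hθ0 (ε := c / 2 / (B + 1)) (by positivity)
  refine ⟨h₀, hh0, hh1, (2 / c).toNNReal, fun Qp qp Q q hQp hqp hQ hq ζ hζ h hh hhh₀ f hf => ?_⟩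
  have hh1' : h ≤ 1 := hhh₀.trans hh1.le
  obtain ⟨g, hg, hfg, hfn⟩ := hf.exists_fourier hζ hh
  have hQp' : ∀ j, ∀ β ∈ Polyharmonic.multiIndices d k, Polyharmonic.holderENorm θ (Qp j β) ≤ M :=
    fun j β hβ => (hQp j β hβ).1
  have hqp' : ∀ β ∈ Polyharmonic.multiIndices d (k + 1), Polyharmonic.holderENorm θ (qp β) ≤ M :=
    fun β hβ => (hqp β hβ).1
  have hBc : B * √h ^ (θ : ℝ) ≤ c / 2 := by
    have h1 := hsmall h hh hhh₀
    rw [le_div_iff₀ (by positivity)] at h1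
    have h2 : 0 ≤ √h ^ (θ : ℝ) := by positivity
    linarith
  have hpert : ∀ v φ, ‖Polyharmonic.pertForm (k + 1) Q q ζ h v φ‖ ≤ c / 2 *
      (‖Polyharmonic.weightFourier (Polyharmonic.isWeight_xWeight hζ hh (k + 1)) φ‖ *
        ‖Polyharmonic.weightFourierInv (Polyharmonic.isWeight_xWeight hζ hh (k + 1)) v‖) := by
    intro v φ
    rw [funext hQ, hq]
    refine (Polyharmonic.norm_pertForm_le hk hθ0 hθ1 hQp' hqp' hζ hh hh1' v φ).trans ?_
    refine mul_le_mul_of_nonneg_right (le_trans (le_of_eq ?_) hBc) (by positivity)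
    rw [hB]
    ring
  obtain ⟨G, hGn, hG⟩ := Polyharmonic.exists_weak_solution hζ hh
    (Polyharmonic.vanishingOutside Ω) hc
    (fun v hv => hap ζ hζ h hh v fun x hx => hΩR x (by_contra fun hxΩ => hx (hv x hxΩ)))
    hpert hg hfg
  obtain ⟨ψ, hψ, hsol⟩ := Polyharmonic.exists_isSolution hθ0 hQp' hqp' hQ hq hζ hh hh1'
    fun v hv => hG v fun x hx => image_eq_zero_of_notMem_tsupport fun hxv => hx (hv hxv)
  have hψn : Polyharmonic.xNorm ζ h (((k + 1 : ℕ) : ℝ) / 2) ψ ≤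
      Polyharmonic.jacobian d ^ (1 / 2 : ℝ) * ‖G‖ₑ := by
    refine (hψ.xNorm_le ζ hh (k + 1)).trans (le_of_eq ?_)
    rw [Lp.enorm_def]
    congr 2 with η
    rw [Complex.ofReal_inv, mul_inv_cancel_left₀ (Complex.ofReal_ne_zero.2
      ((Polyharmonic.isWeight_xWeight hζ hh (k + 1)).pos η).ne')]
  have hGe : ‖G‖ₑ ≤ ((2 / c).toNNReal : ℝ≥0∞) * eLpNorm
      (fun η => ((Polyharmonic.xWeight ζ h (k + 1) η)⁻¹ : ℝ) * g η) 2 volume := by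
    rw [← Lp.enorm_toLp hg, ← ofReal_norm, ← ofReal_norm]
    refine (ENNReal.ofReal_le_ofReal hGn).trans (le_of_eq ?_)
    rw [ENNReal.ofReal_mul (by positivity)]
    rfl
  have hbound : Polyharmonic.xNorm ζ h (((k + 1 : ℕ) : ℝ) / 2) ψ ≤
      (2 / c).toNNReal * Polyharmonic.xNorm ζ h (-((k + 1 : ℕ) : ℝ) / 2) f := by
    refine hψn.trans ?_
    rw [← hfn, mul_left_comm]
    gcongr
  exact ⟨ψ, hbound.trans_lt (ENNReal.mul_lt_top ENNReal.coe_lt_top hf), hsol, hbound⟩
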